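/- **Notation.** For a finite totally ordered set $X$, a partition of $X$ (into non-empty blocks) is non-crossing if $a<b<c<d$, $a\sim c$, $b\sim d$ imply $a\sim b$; $NC^{(A)}(m)$ is the set of non-crossing partitions of $[m]=\{1,\dots,m\}$, and $|p|$ is the number of blocks of $p$. Let $\overline{[m]}$ be a copy of $[m]$ and order $[m]\cup\overline{[m]}$ by $1<\bar 1<2<\bar 2<\dots<m<\bar m$. For $p\in NC^{(A)}(m)$, $\mathrm{Kr}(p)$ is the coarsest partition of $\overline{[m]}$ such that $p\cup \mathrm{Kr}(p)$ is non-crossing. The blocks of a non-crossing partition are totally ordered by: $V\sqsubset W$ iff $\min W<\min V\le\max V<\max W$ or $\max V<\min W$. $\mathrm{Sep}(p,j)$, $1\le j\le m+1$, lists the blocks of $p$ in increasing order, followed by those of $\mathrm{Kr}(p)$ in increasing order; for a non-crossing partition $q$ of $[m]\cup\overline{[m]}$ with $m+1$ blocks, $\mathrm{Mix}(q,j)$ is its $j$-th block. For $k\ge 0$, $n\ge1$ let $\mathrm{Red}:[(k+1)n]\to[n]$ be reduction mod $n$, extended to $[(k+1)n]\cup\overline{[(k+1)n]}$, to subsets and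 to families of subsets. $NC^{(k)}(n)$ is the set of $\pi\in NC^{(A)}((k+1)n)$ such that $\mathrm{Red}(\pi)$ and $\mathrm{Red}(\mathrm{Kr}(\pi))$ are non-crossing partitions of $[n]$ and $\overline{[n]}$. For such $\pi$, a block $V$ of $\pi\cup\mathrm{Kr}(\pi)$ has multiplicity $\mathrm{mult}(V)=|V|/|\mathrm{Red}(V)|$, and the shape $\lambda_\pi\in\mathbb N^{n+1}$ of $\pi$ is $$(\lambda_\pi)_j=\sum_{V:\ \mathrm{Red}(V)=\mathrm{Mix}(\mathrm{Red}(\pi\cup\mathrm{Kr}(\pi)),j)}(\mathrm{mult}(V)-1).$$ For $\lambda\in\mathbb N^{n+1}$ with $\sum_j\lambda_j=k$, $r(\lambda)$ is the number of $\pi\in NC^{(k)}(n)$ with shape $\lambda$ and $\mathrm{Red}(\pi)=p$, where $p\in NC^{(A)}(n)$ is fixed (say the one-block partition). $\mathcal C_k$ is $\mathbb C^{k+1}$ with the product $(\alpha\beta)^{(i)}=\sum_{j=0}^i\binom ij\alpha^{(j)}\beta^{(i-j)}$, $0\le i\le k$. For a commutative ring $\mathcal C$, $\Theta_{\mathcal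 C}$ is the set of power series $\sum_{n\ge1}\alpha_nz^n$ with coefficients in $\mathcal C$. The type-A boxed convolution of $f=\sum\alpha_nz^n$ and $g=\sum\beta_nz^n$ in $\Theta_{\mathcal C}$ is the series with coefficients $$\sum_{p\in NC^{(A)}(m)}\ \prod_{E\in p}\alpha_{|E|}\prod_{F\in\mathrm{Kr}(p)}\beta_{|F|}\qquad(m\ge1).$$ The boxed convolution of type $k$ of $f,g\in\Theta_{\mathcal C_k}$ is $f\star^{(k)}g=\sum_{m\ge1}(\gamma_m^{(0)},\dots,\gamma_m^{(k)})z^m$ with $$\gamma_m^{(i)}=\sum_{\pi\in NC^{(i)}(m)}\frac{i!}{r(\lambda_\pi)\prod_{j}(\lambda_\pi)_j!}\ \prod_{j=1}^{|\mathrm{Red}(\pi)|}\alpha^{((\lambda_\pi)_j)}_{|\mathrm{Sep}(\mathrm{Red}(\pi),j)|}\ \prod_{j=|\mathrm{Red}(\pi)|+1}^{m+1}\beta^{((\lambda_\pi)_j)}_{|\mathrm{Sep}(\mathrm{Red}(\pi),j)|}.$$ **Theorem.** Let $k\ge0$. 1. $\alpha\mapsto\sum_{i=0}^k\frac{\alpha^{(i)}}{i!}X^i$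 is an isomorphism of $\mathbb C$-algebras $\mathcal C_k\cong\mathbb C[X]/(X^{k+1})$. 2. $\star^{(k)}$ is well defined: for all $i\ge0$ and $m\ge1$, the shape of each $\pi\in NC^{(i)}(m)$ has coordinate sum $i$, and for each $\lambda\in\mathbb N^{m+1}$ with coordinate sum $i$ the number of $\pi\in NC^{(i)}(m)$ with shape $\lambda$ and $\mathrm{Red}(\pi)=p$ is the same, $r(\lambda)$, for every $p\in NC^{(A)}(m)$. 3. $f\star^{(k)}g$ equals the type-A boxed convolution of $f$ and $g$ with coefficients in $\mathcal C_k$, for all $f,g\in\Theta_{\mathcal C_k}$. 4. Consequently $\star^{(k)}$ is associative and commutative, the series $\Delta(z)=1_{\mathcal C_k}z$ is its unit element, and $f\in\Theta_{\mathcal C_k}$ is invertible with respect to $\star^{(k)}$ if and only if the first component $\alpha_1^{(0)}$ of its coefficient of degree one is non-zero. -/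

import Mathlib

open Finset Polynomial
open scoped Nat

namespace BoxedConv

/-! ### Non-crossing partitions and the Kreweras complement -/

section Partitions

variable {X : Type*} [Fintype X] [LinearOrder X]

/-- `P` (a family of blocks) is a partition of the finite set `X`. -/
structure IsPart (P : Finset (Finset X)) : Prop where
  nonempty : ∀ V ∈ P, V.Nonempty
  disjoint : ∀ V ∈ P, ∀ W ∈ P, V ≠ W → Disjoint V W
  cover : ∀ x : X, ∃ V ∈ P, x ∈ V

/-- `P` is a non-crossing partition of the finite totally ordered set `X`. -/
structure IsNC (P : Finset (Finset X)) : Prop extends IsPart P where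
  noncrossing : ∀ V ∈ P, ∀ W ∈ P, ∀ a ∈ V, ∀ b ∈ W, ∀ c ∈ V, ∀ d ∈ W,
    a < b → b < c → c < d → V = W

instance (P : Finset (Finset X)) : Decidable (IsPart P) :=
  @decidable_of_iff _ ((∀ V ∈ P, V.Nonempty) ∧ (∀ V ∈ P, ∀ W ∈ P, V ≠ W → Disjoint V W) ∧
    ∀ x : X, ∃ V ∈ P, x ∈ V)
    ⟨fun h => ⟨h.1, h.2.1, h.2.2⟩, fun h => ⟨h.1, h.2, h.3⟩⟩
    (@instDecidableAnd _ _ inferInstance (@instDecidableAnd _ _ inferInstance inferInstance))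

instance (P : Finset (Finset X)) : Decidable (IsNC P) :=
  @decidable_of_iff _ (IsPart P ∧ ∀ V ∈ P, ∀ W ∈ P, ∀ a ∈ V, ∀ b ∈ W, ∀ c ∈ V, ∀ d ∈ W,
    a < b → b < c → c < d → V = W)
    ⟨fun h => ⟨h.1, h.2⟩, fun h => ⟨h.1, h.2⟩⟩
    (@instDecidableAnd _ _ inferInstance inferInstance)

/-- `V` is nested in `W`: `min W < min V ≤ max V < max W`. -/
def Nested (V W : Finset X) : Prop := W.min < V.min ∧ V.max < W.max

/-- `V` is on the left of `W`: `max V < min W`. -/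
def LeftOf (V W : Finset X) : Prop := ∀ v ∈ V, ∀ w ∈ W, v < w

/-- The order on the blocks of a non-crossing partition: `V` is nested in `W` or on its left. -/
def Before (V W : Finset X) : Prop := Nested V W ∨ LeftOf V W

instance (V W : Finset X) : Decidable (Before V W) := by
  unfold Before Nested LeftOf; infer_instance

/-- The number of blocks of `P` that come strictly before the block `V`. -/
def rank (P : Finset (Finset X)) (V : Finset X) : ℕ := #{U ∈ P | Before U V}

/-- The block of `P` in position `i` (counted from `0`) for the order `Before`
(the union of the one-element family of all blocks of rank `i`). -/
def nthBlock (P : Finset (Finset X)) (i : ℕ) : Finset X := {V ∈ P | rank P V = i}.sup id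

end Partitions

/-- `NC^{(A)}(m)`, the set of non-crossing partitions of `[m]`. -/
def NC (m : ℕ) : Finset (Finset (Finset (Fin m))) := {p | IsNC p}

/-- The ordered set `[m] ∪ [m]‾ = {1 < 1‾ < 2 < 2‾ < ⋯ < m < m‾}`: the element `i` is `(i, false)`,
its copy `i‾` is `(i, true)`, and the order is lexicographic. -/
abbrev Doubled (m : ℕ) : Type := Fin m ×ₗ Bool

/-- A set of elements of `[m]`, resp. of its copy, as a subset of `[m] ∪ [m]‾`. -/
def liftBlock {m : ℕ} (c : Bool) (V : Finset (Fin m)) : Finset (Doubled m) :=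
  V.image fun x => toLex (x, c)

/-- `p ∪ q`, for `p` a family of subsets of `[m]` and `q` a family of subsets of the copy of
`[m]`. -/
def join {m : ℕ} (p q : Finset (Finset (Fin m))) : Finset (Finset (Doubled m)) :=
  p.image (liftBlock false) ∪ q.image (liftBlock true)

/-- The block of `x‾` in the Kreweras complement of `p`: it consists of the `y‾` such that no block
of `p` meets both the set of points between `x‾` and `y‾` and its complement. -/
def krBlock {m : ℕ} (p : Finset (Finset (Fin m))) (x : Fin m) : Finset (Fin m) :=
  {y | ∀ V ∈ p, V ⊆ Ioc (min x y) (max x y) ∨ Disjoint V (Ioc (min x y) (max x y))}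

/-- The Kreweras complement. That it is the biggest partition `q` of the copy of `[m]` for
which `p ∪ q` is non-crossing is proved in `Kr_isGreatest` below. -/
def Kr {m : ℕ} (p : Finset (Finset (Fin m))) : Finset (Finset (Fin m)) := univ.image (krBlock p)

/-! ### Non-crossing partitions of type `k` -/

/-- The reduction mod `n` of a subset of `[(k+1)n]`. -/
def redSet {k n : ℕ} (V : Finset (Fin ((k + 1) * n))) : Finset (Fin n) := V.image Fin.modNat

/-- The reduction mod `n` of a family of subsets of `[(k+1)n]`. -/
def Red {k n : ℕ} (π : Finset (Finset (Fin ((k + 1) * n)))) : Finset (Finset (Fin n)) :=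
  π.image redSet

/-- The reduction mod `n` of a subset of `[(k+1)n] ∪ [(k+1)n]‾`, where `i‾` reduces to the copy of
the reduction of `i`. -/
def redDoubled {k n : ℕ} (V : Finset (Doubled ((k + 1) * n))) : Finset (Doubled n) :=
  V.image fun x => toLex (Fin.modNat (ofLex x).1, (ofLex x).2)

/-- `NC^{(k)}(n)`: the non-crossing partitions of `[(k+1)n]` having the mod `n` reduction
property. -/
def NCk (k n : ℕ) : Finset (Finset (Finset (Fin ((k + 1) * n)))) :=
  {π | IsNC π ∧ IsNC (Red π) ∧ IsNC (Red (Kr π))}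

/-- The multiplicity of a block (the division is exact for the blocks of `π ∪ Kr π`,
`π ∈ NC^{(k)}(n)`). -/
def mult {k n : ℕ} (V : Finset (Doubled ((k + 1) * n))) : ℕ := #V / #(redDoubled V)

/-- The shape of `π`: its coordinate `j` is the sum of `mult V - 1` over the blocks `V` of
`π ∪ Kr π` that reduce to the block in position `j` of `Red (π ∪ Kr π)`. -/
def shape {k n : ℕ} (π : Finset (Finset (Fin ((k + 1) * n)))) (j : Fin (n + 1)) : ℕ :=
  ∑ V ∈ join π (Kr π) with redDoubled V = nthBlock ((join π (Kr π)).image redDoubled) j,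
    (mult V - 1)

/-- The number of `π ∈ NC^{(k)}(n)` with reduction `p` and shape `l`. -/
def numShape (k n : ℕ) (p : Finset (Finset (Fin n))) (l : Fin (n + 1) → ℕ) : ℕ :=
  #{π ∈ NCk k n | Red π = p ∧ shape π = l}

/-- `r(l)`: the number of `π ∈ NC^{(k)}(n)` with shape `l` and with reduction a fixed
`p ∈ NC^{(A)}(n)`, here the partition of `[n]` into one block. That the number is the same for every
`p` is part of the theorem. -/
def r (k n : ℕ) (l : Fin (n + 1) → ℕ) : ℕ := numShape k n {univ} l

/-- The blocks of `p` followed by those of `Kr p`, in each case in increasing order; positions are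
counted from `0`. -/
def Sep {m : ℕ} (p : Finset (Finset (Fin m))) (j : ℕ) : Finset (Fin m) :=
  if j < #p then nthBlock p j else nthBlock (Kr p) (j - #p)

/-! ### The algebra `C_k` -/

/-- The vector space `ℂ^{k+1}`, which is given the multiplication
`(a b)^{(i)} = ∑_{j ≤ i} (i choose j) a^{(j)} b^{(i-j)}`. -/
def Ck (k : ℕ) : Type := Fin (k + 1) → ℂ

namespace Ck

variable {k : ℕ}

instance : AddCommGroup (Ck k) := inferInstanceAs (AddCommGroup (Fin (k + 1) → ℂ))
instance : Module ℂ (Ck k) := inferInstanceAs (Module ℂ (Fin (k + 1) → ℂ))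

/-- The component `a^{(j)}` for `j ≤ k` (and `0` for `j > k`). -/
def comp (a : Ck k) (j : ℕ) : ℂ := if h : j < k + 1 then a ⟨j, h⟩ else 0

instance : One (Ck k) := ⟨fun i => if i = 0 then 1 else 0⟩

instance : Mul (Ck k) :=
  ⟨fun a b i => ∑ j ∈ range ((i : ℕ) + 1), (Nat.choose i j : ℂ) * a.comp j * b.comp (i - j)⟩

/-- Auxiliary, for the ring axioms: the map `∑ c_n X^n ↦ (n! c_n)_{n ≤ k}`. -/
noncomputable def ofSeries (k : ℕ) (f : PowerSeries ℂ) : Ck k := fun i => ((i : ℕ)! : ℂ) * PowerSeries.coeff i f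

theorem ofSeries_surjective : Function.Surjective (ofSeries k) := fun a =>
  ⟨PowerSeries.mk fun n => a.comp n / (n ! : ℂ), by
    funext i
    have h : ((i : ℕ)! : ℂ) ≠ 0 := by exact_mod_cast Nat.factorial_ne_zero _
    simp only [ofSeries, PowerSeries.coeff_mk, comp, i.2, dif_pos]
    field_simp⟩

theorem ofSeries_add (f g : PowerSeries ℂ) : ofSeries k (f + g) = ofSeries k f + ofSeries k g := by
  funext i
  show _ = ofSeries k f i + ofSeries k g i
  simp [ofSeries, mul_add]

theorem ofSeries_smul (c : ℂ) (f : PowerSeries ℂ) : ofSeries k (c • f) = c • ofSeries k f := by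
  funext i
  show _ = c • ofSeries k f i
  simp [ofSeries]; ring

theorem ofSeries_one : ofSeries k 1 = 1 := by
  funext i
  show _ = if i = 0 then (1 : ℂ) else 0
  by_cases h : i = 0
  · simp [ofSeries, h]
  · have : (i : ℕ) ≠ 0 := fun h' => h (Fin.ext h')
    simp [ofSeries, PowerSeries.coeff_one, h]

theorem ofSeries_mul (f g : PowerSeries ℂ) : ofSeries k (f * g) = ofSeries k f * ofSeries k g := by
  funext i
  show _ = ∑ j ∈ range ((i : ℕ) + 1),
    (Nat.choose i j : ℂ) * (ofSeries k f).comp j * (ofSeries k g).comp (i - j)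
  have key : ∀ (f : PowerSeries ℂ) (j : ℕ), j ≤ i →
      (ofSeries k f).comp j = (j ! : ℂ) * PowerSeries.coeff j f := fun f j hj => by
    have h : j < k + 1 := by omega
    simp only [comp, h, dif_pos, ofSeries]
  have hL : ofSeries k (f * g) i = ((i : ℕ)! : ℂ) * PowerSeries.coeff i (f * g) := rfl
  rw [hL, PowerSeries.coeff_mul, mul_sum]
  rw [Finset.Nat.sum_antidiagonal_eq_sum_range_succ_mk]
  refine sum_congr rfl fun j hj => ?_
  have hj' : j ≤ i := by simpa [Nat.lt_succ_iff] using hj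
  rw [key f j hj', key g _ (Nat.sub_le _ _)]
  rw [← Nat.choose_mul_factorial_mul_factorial hj']
  push_cast; ring

instance : CommRing (Ck k) where
  __ : AddCommGroup (Ck k) := inferInstance
  mul_assoc a b c := by
    obtain ⟨f, rfl⟩ := ofSeries_surjective a
    obtain ⟨g, rfl⟩ := ofSeries_surjective b
    obtain ⟨h, rfl⟩ := ofSeries_surjective c
    simp only [← ofSeries_mul, mul_assoc]
  mul_comm a b := by
    obtain ⟨f, rfl⟩ := ofSeries_surjective a
    obtain ⟨g, rfl⟩ := ofSeries_surjective b
    simp only [← ofSeries_mul, mul_comm]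
  one_mul a := by
    obtain ⟨f, rfl⟩ := ofSeries_surjective a
    simp only [← ofSeries_mul, ← ofSeries_one, one_mul]
  mul_one a := by
    obtain ⟨f, rfl⟩ := ofSeries_surjective a
    simp only [← ofSeries_mul, ← ofSeries_one, mul_one]
  left_distrib a b c := by
    obtain ⟨f, rfl⟩ := ofSeries_surjective a
    obtain ⟨g, rfl⟩ := ofSeries_surjective b
    obtain ⟨h, rfl⟩ := ofSeries_surjective c
    simp only [← ofSeries_mul, ← ofSeries_add, mul_add]
  right_distrib a b c := by
    obtain ⟨f, rfl⟩ := ofSeries_surjective a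
    obtain ⟨g, rfl⟩ := ofSeries_surjective b
    obtain ⟨h, rfl⟩ := ofSeries_surjective c
    simp only [← ofSeries_mul, ← ofSeries_add, add_mul]
  zero_mul a := by
    obtain ⟨f, rfl⟩ := ofSeries_surjective a
    have h0 : (0 : Ck k) = ofSeries k 0 := by
      funext i; show (0 : ℂ) = _; simp [ofSeries]
    rw [h0, ← ofSeries_mul, zero_mul]
  mul_zero a := by
    obtain ⟨f, rfl⟩ := ofSeries_surjective a
    have h0 : (0 : Ck k) = ofSeries k 0 := by
      funext i; show (0 : ℂ) = _; simp [ofSeries]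
    rw [h0, ← ofSeries_mul, mul_zero]

instance : Algebra ℂ (Ck k) :=
  Algebra.ofModule
    (fun c a b => by
      obtain ⟨f, rfl⟩ := ofSeries_surjective a
      obtain ⟨g, rfl⟩ := ofSeries_surjective b
      simp only [← ofSeries_mul, ← ofSeries_smul, smul_mul_assoc])
    (fun c a b => by
      obtain ⟨f, rfl⟩ := ofSeries_surjective a
      obtain ⟨g, rfl⟩ := ofSeries_surjective b
      simp only [← ofSeries_mul, ← ofSeries_smul, mul_smul_comm])

end Ck

/-! ### The boxed convolutions -/

/-- `Θ_C^{(A)}`: the power series `∑_{n ≥ 1} α_n z^n` with coefficients in `C`. The set `Θ^{(k)}`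
of series with coefficients in `ℂ^{k+1}` is `Theta (Ck k)`. -/
def Theta (C : Type*) [CommRing C] : Type _ := {f : PowerSeries C // PowerSeries.constantCoeff f = 0}

namespace Theta

variable {C : Type*} [CommRing C]

/-- The coefficient of degree `n`. -/
noncomputable def coeff (f : Theta C) (n : ℕ) : C := PowerSeries.coeff n f.1

/-- The series `∑_{n ≥ 1} γ_n z^n`. -/
noncomputable def mk (γ : ℕ → C) : Theta C :=
  ⟨PowerSeries.mk fun n => if n = 0 then 0 else γ n, by
    rw [← PowerSeries.coeff_zero_eq_constantCoeff_apply, PowerSeries.coeff_mk, if_pos rfl]⟩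

/-- The series `Δ(z) = 1 z`. -/
noncomputable def delta : Theta C := mk fun n => if n = 1 then 1 else 0

end Theta

/-- The boxed convolution of type A with coefficients in `C`. -/
noncomputable def boxA {C : Type*} [CommRing C] (f g : Theta C) : Theta C :=
  Theta.mk fun m => ∑ p ∈ NC m, (∏ E ∈ p, f.coeff #E) * ∏ F ∈ Kr p, g.coeff #F

/-- The multinomial coefficient `i! / (l_1! ⋯ l_n!)`. -/
noncomputable def multinom {n : ℕ} (i : ℕ) (l : Fin n → ℕ) : ℂ := (i ! : ℂ) / ∏ j, ((l j)! : ℂ)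

/-- The boxed convolution of type `k`. -/
noncomputable def boxK {k : ℕ} (f g : Theta (Ck k)) : Theta (Ck k) :=
  Theta.mk fun m => fun i : Fin (k + 1) =>
    ∑ π ∈ NCk i m,
      multinom i (shape π) / (r i m (shape π) : ℂ) *
        (∏ j : Fin (m + 1) with j.1 < #(Red π),
          (f.coeff #(Sep (Red π) j)).comp (shape π j)) *
        ∏ j : Fin (m + 1) with #(Red π) ≤ j.1,
          (g.coeff #(Sep (Red π) j)).comp (shape π j)

/-! ### The Kreweras complement and the order on blocks are the intended ones -/

theorem IsPart.eq_of_mem {X : Type*} [Fintype X] [LinearOrder X] {P : Finset (Finset X)}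
    (hP : IsPart P) {V W : Finset X} {x : X} (hV : V ∈ P) (hW : W ∈ P) (hxV : x ∈ V)
    (hxW : x ∈ W) : V = W := by
  by_contra h
  exact Finset.disjoint_left.1 (hP.disjoint V hV W hW h) hxV hxW

theorem before_iff {X : Type*} [Fintype X] [LinearOrder X] {P : Finset (Finset X)} (hP : IsNC P)
    {V W : Finset X} (hV : V ∈ P) (hW : W ∈ P) : Before V W ↔ V.max < W.max := by
  obtain ⟨v, hv⟩ := Finset.max_of_nonempty (hP.nonempty V hV)
  obtain ⟨w, hw⟩ := Finset.max_of_nonempty (hP.nonempty W hW)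
  have hvV := Finset.mem_of_max hv
  have hwW := Finset.mem_of_max hw
  constructor
  · rintro (h | h)
    · exact h.2
    · rw [hv, hw]
      exact WithBot.coe_lt_coe.2 (h v hvV w hwW)
  · intro h
    have hne : V ≠ W := fun h' => by simp [h'] at h
    by_cases hl : LeftOf V W
    · exact Or.inr hl
    refine Or.inl ⟨?_, h⟩
    unfold LeftOf at hl
    push Not at hl
    obtain ⟨c, hc, b, hb, hbc⟩ := hl
    obtain ⟨a, ha⟩ := Finset.min_of_nonempty (hP.nonempty V hV)
    obtain ⟨e, he⟩ := Finset.min_of_nonempty (hP.nonempty W hW)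
    have haV := Finset.mem_of_min ha
    have heW := Finset.mem_of_min he
    rw [ha, he, WithTop.coe_lt_coe]
    by_contra hae
    rw [hv, hw, WithBot.coe_lt_coe] at h
    have hac : a ≠ e := fun h' => hne (hP.eq_of_mem hV hW haV (h' ▸ heW))
    have hbc' : b ≠ c := fun h' => hne (hP.eq_of_mem hV hW hc (h' ▸ hb))
    have heb : e ≤ b := Finset.min_le_of_eq hb he
    have hcv : c ≤ v := Finset.le_max_of_eq hc hv
    exact hne (hP.noncrossing V hV W hW a haV b hb c hc w hwW
      ((lt_of_le_of_ne (not_lt.1 hae) hac).trans_le heb) (lt_of_le_of_ne hbc hbc')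
      (hcv.trans_lt h))

theorem rank_lt {X : Type*} [Fintype X] [LinearOrder X] {P : Finset (Finset X)} (hP : IsNC P)
    {V : Finset X} (hV : V ∈ P) : rank P V < #P :=
  Finset.card_lt_card (Finset.filter_ssubset.2
    ⟨V, hV, fun h => lt_irrefl _ ((before_iff hP hV hV).1 h)⟩)

theorem nthBlock_rank {X : Type*} [Fintype X] [LinearOrder X] {P : Finset (Finset X)} (hP : IsNC P)
    {V : Finset X} (hV : V ∈ P) : nthBlock P (rank P V) = V := by
  have mono : ∀ U ∈ P, ∀ W ∈ P, U.max < W.max → rank P U < rank P W := by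
    intro U hU W hW h
    refine Finset.card_lt_card (Finset.ssubset_iff_of_subset ?_ |>.2 ⟨U, ?_, ?_⟩)
    · intro T hT
      simp only [Finset.mem_filter] at hT ⊢
      exact ⟨hT.1, (before_iff hP hT.1 hW).2 (((before_iff hP hT.1 hU).1 hT.2).trans h)⟩
    · simp only [Finset.mem_filter]
      exact ⟨hU, (before_iff hP hU hW).2 h⟩
    · simp only [Finset.mem_filter]
      exact fun h' => lt_irrefl _ ((before_iff hP hU hU).1 h'.2)
  have : {W ∈ P | rank P W = rank P V} = {V} := by
    ext W
    simp only [Finset.mem_filter, Finset.mem_singleton]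
    refine ⟨fun ⟨hW, h⟩ => ?_, fun h => by rw [h]; exact ⟨hV, rfl⟩⟩
    have hm : W.max = V.max := by
      rcases lt_trichotomy W.max V.max with h' | h' | h'
      · exact absurd h (mono W hW V hV h').ne
      · exact h'
      · exact absurd h (mono V hV W hW h').ne'
    obtain ⟨v, hv⟩ := Finset.max_of_nonempty (hP.nonempty V hV)
    exact hP.eq_of_mem hW hV (Finset.mem_of_max (hm.trans hv)) (Finset.mem_of_max hv)
  simp [nthBlock, this]

theorem mem_krBlock {m : ℕ} {p : Finset (Finset (Fin m))} {x y : Fin m} :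
    y ∈ krBlock p x ↔ ∀ V ∈ p, ∀ a ∈ V, ∀ b ∈ V,
      (min x y < a ∧ a ≤ max x y) → (min x y < b ∧ b ≤ max x y) := by
  simp only [krBlock, Finset.mem_filter, Finset.mem_univ, true_and]
  constructor
  · intro h V hV a ha b hb hab
    rcases h V hV with h | h
    · exact Finset.mem_Ioc.1 (h hb)
    · exact absurd (Finset.mem_Ioc.2 hab) (Finset.disjoint_left.1 h ha)
  · intro h V hV
    by_cases hd : Disjoint V (Ioc (min x y) (max x y))
    · exact Or.inr hd
    · obtain ⟨a, ha, ha'⟩ := Finset.not_disjoint_iff.1 hd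
      exact Or.inl fun b hb => Finset.mem_Ioc.2 (h V hV a ha b hb (Finset.mem_Ioc.1 ha'))

/-- Equivalent form: `y` is in the block of `x` iff, for each block of `p`, the points of this block
lie all or none between `x` and `y`. -/
theorem mem_krBlock' {m : ℕ} {p : Finset (Finset (Fin m))} {x y : Fin m} :
    y ∈ krBlock p x ↔ ∀ V ∈ p, ∀ a ∈ V, ∀ b ∈ V, ((a ≤ x ↔ a ≤ y) ↔ (b ≤ x ↔ b ≤ y)) := by
  rw [mem_krBlock]
  have aux : ∀ a : Fin m, (min x y < a ∧ a ≤ max x y) ↔ ¬ (a ≤ x ↔ a ≤ y) := by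
    intro a; simp only [min_lt_iff, le_max_iff, Fin.le_def, Fin.lt_def]; omega
  simp only [aux]
  constructor
  · intro h V hV a ha b hb
    have h1 := h V hV a ha b hb
    have h2 := h V hV b hb a ha
    tauto
  · intro h V hV a ha b hb
    have h1 := h V hV a ha b hb
    tauto

theorem Kr_isPart {m : ℕ} (p : Finset (Finset (Fin m))) : IsPart (Kr p) := by
  have hself : ∀ x, x ∈ krBlock p x := fun x => mem_krBlock'.2 (by simp)
  have heq : ∀ x y, y ∈ krBlock p x → krBlock p x = krBlock p y := by
    intro x y h
    ext z
    simp only [mem_krBlock'] at h ⊢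
    constructor <;>
    · intro h' V hV a ha b hb
      have h1 := h V hV a ha b hb
      have h2 := h' V hV a ha b hb
      tauto
  refine ⟨?_, ?_, fun x => ⟨krBlock p x, Finset.mem_image_of_mem _ (Finset.mem_univ x), hself x⟩⟩
  · intro V hV
    obtain ⟨x, -, rfl⟩ := Finset.mem_image.1 hV
    exact ⟨x, hself x⟩
  · intro V hV W hW hne
    obtain ⟨x, -, rfl⟩ := Finset.mem_image.1 hV
    obtain ⟨y, -, rfl⟩ := Finset.mem_image.1 hW
    refine Finset.disjoint_left.2 fun z hz hz' => hne ?_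
    rw [heq x z hz, heq y z hz']

theorem mem_join {m : ℕ} {p q : Finset (Finset (Fin m))} {V : Finset (Doubled m)} :
    V ∈ join p q ↔ (∃ E ∈ p, liftBlock false E = V) ∨ ∃ F ∈ q, liftBlock true F = V := by
  simp [join]

theorem mem_liftBlock {m : ℕ} {c : Bool} {E : Finset (Fin m)} {x : Doubled m} :
    x ∈ liftBlock c E ↔ (ofLex x).1 ∈ E ∧ (ofLex x).2 = c := by
  simp only [liftBlock, Finset.mem_image]
  constructor
  · rintro ⟨y, hy, rfl⟩
    exact ⟨hy, rfl⟩
  · rintro ⟨h1, h2⟩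
    exact ⟨_, h1, by rw [← h2]; rfl⟩

theorem doubled_lt {m : ℕ} {x y : Doubled m} :
    x < y ↔ (ofLex x).1 < (ofLex y).1 ∨
      (ofLex x).1 = (ofLex y).1 ∧ (ofLex x).2 = false ∧ (ofLex y).2 = true := by
  rw [Prod.Lex.lt_iff, Bool.lt_iff]

theorem join_isPart {m : ℕ} {p q : Finset (Finset (Fin m))} (hp : IsPart p) (hq : IsPart q) :
    IsPart (join p q) := by
  refine ⟨?_, ?_, ?_⟩
  · intro V hV
    rcases mem_join.1 hV with ⟨E, hE, rfl⟩ | ⟨E, hE, rfl⟩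
    · exact (hp.nonempty E hE).image _
    · exact (hq.nonempty E hE).image _
  · intro V hV W hW hne
    refine Finset.disjoint_left.2 fun z hz hz' => hne ?_
    rcases mem_join.1 hV with ⟨E, hE, rfl⟩ | ⟨E, hE, rfl⟩ <;>
    rcases mem_join.1 hW with ⟨F, hF, rfl⟩ | ⟨F, hF, rfl⟩ <;>
    rw [mem_liftBlock] at hz hz'
    · rw [hp.eq_of_mem hE hF hz.1 hz'.1]
    · exact absurd (hz.2.symm.trans hz'.2) (by simp)
    · exact absurd (hz.2.symm.trans hz'.2) (by simp)
    · rw [hq.eq_of_mem hE hF hz.1 hz'.1]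
  · intro x
    rcases hc : (ofLex x).2 with _ | _
    · obtain ⟨E, hE, hx⟩ := hp.cover (ofLex x).1
      exact ⟨_, mem_join.2 (Or.inl ⟨E, hE, rfl⟩), mem_liftBlock.2 ⟨hx, hc⟩⟩
    · obtain ⟨E, hE, hx⟩ := hq.cover (ofLex x).1
      exact ⟨_, mem_join.2 (Or.inr ⟨E, hE, rfl⟩), mem_liftBlock.2 ⟨hx, hc⟩⟩

theorem mem_Kr_closed {m : ℕ} {p : Finset (Finset (Fin m))} {F : Finset (Fin m)} (hF : F ∈ Kr p)
    {x y : Fin m} (hx : x ∈ F) (hy : y ∈ F) {V : Finset (Fin m)} (hV : V ∈ p) {a b : Fin m}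
    (ha : a ∈ V) (hb : b ∈ V) : (a ≤ x ↔ a ≤ y) ↔ (b ≤ x ↔ b ≤ y) := by
  obtain ⟨z, -, rfl⟩ := Finset.mem_image.1 hF
  have h1 := mem_krBlock'.1 hx V hV a ha b hb
  have h2 := mem_krBlock'.1 hy V hV a ha b hb
  tauto

theorem join_Kr_isNC {m : ℕ} {p : Finset (Finset (Fin m))} (hp : IsNC p) :
    IsNC (join p (Kr p)) := by
  refine ⟨join_isPart hp.toIsPart (Kr_isPart p), ?_⟩
  intro V hV W hW a ha b hb c hc d hd hab hbc hcd
  rcases mem_join.1 hV with ⟨E, hE, rfl⟩ | ⟨E, hE, rfl⟩ <;>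
  rcases mem_join.1 hW with ⟨F, hF, rfl⟩ | ⟨F, hF, rfl⟩ <;>
  rw [mem_liftBlock] at ha hb hc hd <;>
  simp only [doubled_lt, ha.2, hb.2, hc.2, hd.2, Bool.false_eq_true, and_false,
    or_false, reduceCtorEq, and_true] at hab hbc hcd
  · rw [hp.noncrossing E hE F hF _ ha.1 _ hb.1 _ hc.1 _ hd.1 hab hbc hcd]
  · have := mem_Kr_closed hF hb.1 hd.1 hE ha.1 hc.1
    simp only [Fin.le_def, Fin.lt_def, Fin.ext_iff] at *
    omega
  · have := mem_Kr_closed hE ha.1 hc.1 hF hb.1 hd.1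
    simp only [Fin.le_def, Fin.lt_def, Fin.ext_iff] at *
    omega
  · suffices h : (ofLex b).1 ∈ E by rw [(Kr_isPart p).eq_of_mem hE hF h hb.1]
    obtain ⟨z, -, rfl⟩ := Finset.mem_image.1 hE
    rw [mem_krBlock']
    intro V hV u hu v hv
    have h1 := mem_krBlock'.1 ha.1 V hV u hu v hv
    have h2 := mem_krBlock'.1 hc.1 V hV u hu v hv
    have h3 := mem_Kr_closed hF hb.1 hd.1 hV hu hv
    simp only [Fin.le_def, Fin.lt_def] at *
    omega

/-- `Kr p` is the biggest partition `q` such that `p ∪ q` is a non-crossing partition. -/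
theorem Kr_isGreatest {m : ℕ} {p : Finset (Finset (Fin m))} (hp : IsNC p) :
    IsPart (Kr p) ∧ IsNC (join p (Kr p)) ∧
      ∀ q, IsPart q → IsNC (join p q) → ∀ W ∈ q, ∃ F ∈ Kr p, W ⊆ F := by
  refine ⟨Kr_isPart p, join_Kr_isNC hp, fun q hq hpq W hW => ?_⟩
  obtain ⟨x, hx⟩ := hq.nonempty W hW
  refine ⟨krBlock p x, Finset.mem_image_of_mem _ (Finset.mem_univ x), fun y hy => ?_⟩
  rw [mem_krBlock]
  intro V hV a ha b hb ⟨h1, h2⟩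
  have hlo : min x y ∈ W := by rcases min_choice x y with h | h <;> rwa [h]
  have hhi : max x y ∈ W := by rcases max_choice x y with h | h <;> rwa [h]
  have hV' : liftBlock false V ∈ join p q := mem_join.2 (Or.inl ⟨V, hV, rfl⟩)
  have hW' : liftBlock true W ∈ join p q := mem_join.2 (Or.inr ⟨W, hW, rfl⟩)
  have hne : liftBlock false V ≠ liftBlock true W := fun h => by
    have : toLex (a, false) ∈ liftBlock true W := h ▸ mem_liftBlock.2 ⟨ha, rfl⟩
    exact absurd (mem_liftBlock.1 this).2 (by simp)
  have mV : ∀ {u}, u ∈ V → toLex (u, false) ∈ liftBlock false V :=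
    fun hu => mem_liftBlock.2 ⟨hu, rfl⟩
  have mW : ∀ {u}, u ∈ W → toLex (u, true) ∈ liftBlock true W :=
    fun hu => mem_liftBlock.2 ⟨hu, rfl⟩
  have l1 : ∀ {u v : Fin m}, u ≤ v → (toLex (u, false) : Doubled m) < toLex (v, true) :=
    fun h => doubled_lt.2 ((lt_or_eq_of_le h).imp id fun h => ⟨h, rfl, rfl⟩)
  have l2 : ∀ {u v : Fin m}, u < v → (toLex (u, true) : Doubled m) < toLex (v, false) :=
    fun h => doubled_lt.2 (Or.inl h)
  by_contra hcon
  rcases not_and_or.1 hcon with h | h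
  · exact hne (hpq.noncrossing _ hV' _ hW' _ (mV hb) _ (mW hlo) _ (mV ha) _ (mW hhi)
      (l1 (not_lt.1 h)) (l2 h1) (l1 h2))
  · exact hne (hpq.noncrossing _ hW' _ hV' _ (mW hlo) _ (mV ha) _ (mW hhi) _ (mV hb)
      (l2 h1) (l1 h2) (l2 (not_le.1 h))).symm

end BoxedConv

open BoxedConv

namespace BoxedConv

open Equiv

/-! ### Orbits of a permutation and invariant functions -/

section Orbits

variable {X Y : Type*} [Fintype X] [DecidableEq X] [Fintype Y] [DecidableEq Y]

/-! Everything is translated into permutations. Let `c` be the long cycle of `[m]`. Non-crossing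
partitions of `[m]` are the orbit families of the permutations `α` for which `α` and `α⁻¹ c` have `m
+ 1` orbits in total. Such an `α` is determined by its orbits, and `α⁻¹ c` has the Kreweras
complement as its orbits (`exists_geo`, `Geo.ext`, `Geo.Kr_eq`). The tool is linear algebra: the
number of orbits is the dimension of the space of invariant functions. The inequality
`card_orbs_add_le` is then the dimension formula for a sum and an intersection of subspaces, and
`geodesic_iff` describes equality.

The type-A convolution becomes a sum over minimal factorizations of a long cycle. The same sum over
minimal factorizations of an arbitrary `δ` is multiplicative over the cycles of `δ`
(`cycleProd_conv`). Hence associativity is a statement about minimal factorizations into three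
factors, and commutativity comes from `α ↦ α⁻¹ δ`. Inverses are found recursively, the coefficient
of the new unknown in degree `m` being the `m`-th power of the first coefficient.

A partition of type `k` is a geodesic `α` on `[(k+1)n]` that descends mod `n` to a geodesic `a` on
`[n]` (`exists_isLift`). The lifts of a fixed `a` are skew products over `a`. In suitable
coordinates they are the arbitrary sequences `1, q 0, …, q (n - 1), c` of permutations of `k + 1`
points, now with `c` their long cycle. The blocks lying over the `j`-th block of `p ∪ Kr p`
correspond to the cycles of the `j`-th increment of this sequence. So the lift is geodesic exactly
when the lengths of the increments add up to `k`, and the shape is the list of these lengths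
(`Geo.geo_skew_iff`, `Geo.shape_skew`). Nothing in this description depends on `a`, hence the count
is the same for every `p`; it is positive because paths with prescribed step lengths exist
(`exists_incOrbs`).

Finally, grouping the sum of type `k` by reduction and shape cancels `r`. What remains is the
multinomial expansion of a component of a product in `C_k` (`Ck.prod_apply`), so the two
convolutions agree and the algebraic properties carry over from type A. -/

theorem eq_of_sameCycle {X A : Type*} [Finite X] {α : Perm X} {f : X → A}
    (hf : ∀ x, f (α x) = f x) {x y : X} (h : α.SameCycle x y) : f x = f y := by
  obtain ⟨n, rfl⟩ := h.exists_nat_pow_eq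
  induction n with
  | zero => rfl
  | succ n ih =>
    rw [pow_succ', Perm.mul_apply, hf]
    exact ih ⟨n, by simp⟩

theorem sameCycle_map {X Y : Type*} [Finite X] {α : Perm X} {β : Perm Y} {f : X → Y}
    (hf : ∀ x, β.SameCycle (f x) (f (α x))) {x y : X} (h : α.SameCycle x y) :
    β.SameCycle (f x) (f y) := by
  obtain ⟨n, rfl⟩ := h.exists_nat_pow_eq
  clear h
  induction n with
  | zero => exact Perm.SameCycle.refl _ _
  | succ n ih =>
    rw [pow_succ', Perm.mul_apply]
    exact ih.trans (hf _)

/-- The orbit of `x` under the permutation `α`. -/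
def orb (α : Perm X) (x : X) : Finset X := {y | α.SameCycle x y}

/-- The family of orbits of a permutation. -/
def orbs (α : Perm X) : Finset (Finset X) := univ.image (orb α)

variable {α β : Perm X} {x y : X} {E : Finset X}

theorem mem_orb : y ∈ orb α x ↔ α.SameCycle x y := by simp [orb]

theorem self_mem_orb (α : Perm X) (x : X) : x ∈ orb α x := mem_orb.2 (Perm.SameCycle.refl _ _)

theorem orb_mem_orbs (α : Perm X) (x : X) : orb α x ∈ orbs α := mem_image_of_mem _ (mem_univ x)

theorem mem_orbs : E ∈ orbs α ↔ ∃ x, orb α x = E := by simp [orbs]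

theorem orb_eq_orb : orb α x = orb α y ↔ α.SameCycle x y := by
  constructor
  · intro h
    exact mem_orb.1 (h ▸ self_mem_orb α y)
  · intro h
    ext z
    rw [mem_orb, mem_orb]
    exact ⟨h.symm.trans, h.trans⟩

theorem orb_eq_of_mem (hE : E ∈ orbs α) (hx : x ∈ E) : orb α x = E := by
  obtain ⟨y, rfl⟩ := mem_orbs.1 hE
  exact (orb_eq_orb.2 (mem_orb.1 hx)).symm

theorem orb_apply (α : Perm X) (x : X) : orb α (α x) = orb α x :=
  orb_eq_orb.2 (Perm.sameCycle_apply_left.2 (Perm.SameCycle.refl _ _))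

theorem nonempty_of_mem_orbs (hE : E ∈ orbs α) : E.Nonempty := by
  obtain ⟨y, rfl⟩ := mem_orbs.1 hE
  exact ⟨y, self_mem_orb α y⟩

theorem apply_mem_iff (hE : E ∈ orbs α) : α x ∈ E ↔ x ∈ E := by
  obtain ⟨y, rfl⟩ := mem_orbs.1 hE
  rw [mem_orb, mem_orb, Perm.sameCycle_apply_right]

theorem sameCycle_iff_of_mem (hE : E ∈ orbs α) (hx : x ∈ E) : α.SameCycle x y ↔ y ∈ E := by
  rw [← mem_orb, orb_eq_of_mem hE hx]

/-- The functions on `X` that factor through `f`. -/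
noncomputable def factorFns {X Y : Type*} (f : X → Y) : Submodule ℚ (X → ℚ) :=
  LinearMap.range (LinearMap.funLeft ℚ ℚ f)

theorem mem_factorFns {X Y : Type*} {f : X → Y} {h : X → ℚ} :
    h ∈ factorFns f ↔ ∃ g : Y → ℚ, ∀ x, h x = g (f x) := by
  constructor
  · rintro ⟨g, rfl⟩
    exact ⟨g, fun x => rfl⟩
  · rintro ⟨g, hg⟩
    exact ⟨g, funext fun x => (hg x).symm⟩

theorem finrank_factorFns {X Y : Type*} [Fintype Y] {f : X → Y} (hf : Function.Surjective f) :
    Module.finrank ℚ (factorFns f) = Fintype.card Y := by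
  rw [factorFns, LinearMap.finrank_range_of_inj (LinearMap.funLeft_injective_of_surjective _ _ _ hf)]
  simp

/-- The functions that are invariant under a permutation. -/
def fixedFns {X : Type*} (α : Perm X) : Submodule ℚ (X → ℚ) where
  carrier := {h | ∀ x, h (α x) = h x}
  add_mem' := fun ha hb x => by simp [ha x, hb x]
  zero_mem' := fun x => rfl
  smul_mem' := fun c h hh x => by simp [hh x]

theorem mem_fixedFns {X : Type*} {α : Perm X} {h : X → ℚ} :
    h ∈ fixedFns α ↔ ∀ x, h (α x) = h x := Iff.rfl

theorem fixedFns_eq (α : Perm X) :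
    fixedFns α = factorFns fun x => (⟨orb α x, orb_mem_orbs α x⟩ : orbs α) := by
  ext h
  rw [mem_fixedFns, mem_factorFns]
  constructor
  · intro hh
    refine ⟨fun E => h (nonempty_of_mem_orbs E.2).choose, fun x => eq_of_sameCycle hh ?_⟩
    exact mem_orb.1 (nonempty_of_mem_orbs (orb_mem_orbs α x)).choose_spec
  · rintro ⟨g, hg⟩ x
    rw [hg, hg]
    congr 2
    exact orb_apply α x

theorem finrank_fixedFns (α : Perm X) : Module.finrank ℚ (fixedFns α) = #(orbs α) := by
  rw [fixedFns_eq, finrank_factorFns, Fintype.card_coe]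
  rintro ⟨E, hE⟩
  obtain ⟨x, rfl⟩ := mem_orbs.1 hE
  exact ⟨x, rfl⟩

theorem fixedFns_inf_le {X : Type*} (α β : Perm X) : fixedFns α ⊓ fixedFns β ≤ fixedFns (α * β) := by
  rintro h ⟨h1, h2⟩ x
  rw [Perm.mul_apply, h1, h2]

/-- A function invariant under both `α` and `β` is invariant under `α * β`, so the intersection of
the two spaces of invariants is at most as large as the invariants of the product, while their sum
has dimension at most `card X`. -/
theorem card_orbs_add_le (α β : Perm X) :
    #(orbs α) + #(orbs β) ≤ Fintype.card X + #(orbs (α * β)) := by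
  rw [← finrank_fixedFns, ← finrank_fixedFns, ← finrank_fixedFns,
    ← Submodule.finrank_sup_add_finrank_inf_eq, ← Module.finrank_pi ℚ (ι := X)]
  exact add_le_add (Submodule.finrank_le _) (Submodule.finrank_mono (fixedFns_inf_le α β))

/-- Equality in the dimension count forces equality in both estimates behind it. -/
theorem geodesic_iff (α β : Perm X) :
    #(orbs α) + #(orbs β) = Fintype.card X + #(orbs (α * β)) ↔
      fixedFns α ⊔ fixedFns β = ⊤ ∧ fixedFns α ⊓ fixedFns β = fixedFns (α * β) := by
  rw [← finrank_fixedFns, ← finrank_fixedFns, ← finrank_fixedFns,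
    ← Submodule.finrank_sup_add_finrank_inf_eq, ← Module.finrank_pi ℚ (ι := X)]
  have h1 := Submodule.finrank_le (fixedFns α ⊔ fixedFns β)
  have h2 := Submodule.finrank_mono (fixedFns_inf_le α β)
  constructor
  · intro h
    exact ⟨Submodule.eq_top_of_finrank_eq (by omega),
      Submodule.eq_of_le_of_finrank_eq (fixedFns_inf_le α β) (by omega)⟩
  · rintro ⟨h3, h4⟩
    rw [h3, h4, finrank_top]

theorem orb_permCongr (e : X ≃ Y) (α : Perm X) (x : X) :
    orb (e.permCongr α) (e x) = (orb α x).map e.toEmbedding := by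
  ext y
  obtain ⟨z, rfl⟩ := e.surjective y
  rw [mem_orb, mem_map_equiv, e.symm_apply_apply, mem_orb]
  constructor
  · intro h
    have := sameCycle_map (β := α) (f := e.symm) (fun x => by
      simp [Perm.sameCycle_apply_right, Perm.SameCycle.refl]) h
    simpa using this
  · intro h
    exact sameCycle_map (β := e.permCongr α) (f := e) (fun x => by
      have : e (α x) = e.permCongr α (e x) := by simp
      rw [this, Perm.sameCycle_apply_right]) h

theorem orbs_permCongr (e : X ≃ Y) (α : Perm X) :
    orbs (e.permCongr α) = (orbs α).image fun E => E.map e.toEmbedding := by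
  ext E
  simp only [mem_orbs, mem_image, exists_exists_eq_and]
  constructor
  · rintro ⟨y, rfl⟩
    exact ⟨e.symm y, by rw [← orb_permCongr, e.apply_symm_apply]⟩
  · rintro ⟨x, rfl⟩
    exact ⟨e x, orb_permCongr e α x⟩

theorem prod_orbs_permCongr {M : Type*} [CommMonoid M] (f : ℕ → M) (e : X ≃ Y) (α : Perm X) :
    ∏ E ∈ orbs (e.permCongr α), f #E = ∏ E ∈ orbs α, f #E := by
  rw [orbs_permCongr, prod_image fun a _ b _ h => Finset.map_injective _ h]
  simp

theorem card_orbs_permCongr (e : X ≃ Y) (α : Perm X) : #(orbs (e.permCongr α)) = #(orbs α) := by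
  rw [orbs_permCongr, card_image_of_injective _ (Finset.map_injective _)]

theorem sum_card_orbs (α : Perm X) : ∑ E ∈ orbs α, #E = Fintype.card X := by
  rw [← card_biUnion, ← card_univ]
  · congr 1
    ext x
    simp only [mem_biUnion, mem_univ, iff_true]
    exact ⟨_, orb_mem_orbs α x, self_mem_orb α x⟩
  · intro V hV W hW hne
    refine Finset.disjoint_left.2 fun z hz hz' => hne ?_
    rw [← orb_eq_of_mem hV hz, ← orb_eq_of_mem hW hz']

theorem orbs_one : orbs (1 : Perm X) = univ.image fun x => {x} := by
  refine image_congr fun x _ => ?_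
  ext y
  simp [mem_orb, Perm.sameCycle_one, eq_comm]

theorem card_orbs_one : #(orbs (1 : Perm X)) = Fintype.card X := by
  rw [orbs_one, card_image_of_injective _ singleton_injective, card_univ]

theorem card_orbs_le (α : Perm X) : #(orbs α) ≤ Fintype.card X := card_image_le

theorem permCongr_eq_conj {X : Type*} (α β : Perm X) : β.permCongr α = β * α * β⁻¹ := by
  ext x; simp

end Orbits

/-! ### The long cycle. -/

section Rotate

variable {m : ℕ}

theorem val_finRotate (x : Fin m) :
    (finRotate m x : ℕ) = if (x : ℕ) + 1 = m then 0 else (x : ℕ) + 1 := by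
  cases m with
  | zero => exact x.elim0
  | succ m =>
    rw [coe_finRotate]
    simp [Fin.ext_iff]

theorem finRotate_const {A : Type*} {h : Fin m → A} (hh : ∀ x, h (finRotate m x) = h x)
    (x y : Fin m) : h x = h y := by
  have key : ∀ n (hn : n < m), h ⟨n, hn⟩ = h ⟨0, by omega⟩ := by
    intro n
    induction n with
    | zero => intro _; rfl
    | succ n ih =>
      intro hn
      -- One step of the rotation leads from `n` to `n + 1`; the wrap-around is not needed.
      rw [← ih (by omega), ← hh ⟨n, by omega⟩]
      congr 1
      ext
      rw [val_finRotate]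
      simp [hn.ne]
  rw [key x x.2, key y y.2]

theorem orb_finRotate (x : Fin m) : orb (finRotate m) x = univ := by
  have h := fun y => finRotate_const (h := orb (finRotate m)) (orb_apply _) x y
  ext y
  simp [h y, self_mem_orb]

theorem orbs_finRotate (hm : 0 < m) : orbs (finRotate m) = {univ} := by
  ext E
  simp only [mem_orbs, orb_finRotate, mem_singleton]
  exact ⟨fun ⟨_, h⟩ => h.symm, fun h => ⟨⟨0, hm⟩, h.symm⟩⟩

theorem card_orbs_finRotate (hm : 0 < m) : #(orbs (finRotate m)) = 1 := by
  rw [orbs_finRotate hm, card_singleton]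

end Rotate

/-! ### Non-crossing partitions as geodesic permutations -/

section Geodesic

variable {m : ℕ}

/-- The permutation `α⁻¹ c`, where `c` is the long cycle: the Kreweras complement of `α`. -/
def krPerm (α : Perm (Fin m)) : Perm (Fin m) := α⁻¹ * finRotate m

/-- `α` lies on a geodesic from the identity to the long cycle. -/
def Geo (α : Perm (Fin m)) : Prop := #(orbs α) + #(orbs (krPerm α)) = m + 1

instance : DecidablePred (Geo (m := m)) := fun _ => inferInstanceAs (Decidable (_ = _))

theorem mul_krPerm (α : Perm (Fin m)) : α * krPerm α = finRotate m := by simp [krPerm]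

theorem apply_krPerm (α : Perm (Fin m)) (x : Fin m) : α (krPerm α x) = finRotate m x := by
  rw [← Perm.mul_apply, mul_krPerm]

/-- Complementing twice is conjugation by the long cycle, which preserves all cycle lengths. -/
theorem krPerm_krPerm (α : Perm (Fin m)) :
    krPerm (krPerm α) = (finRotate m)⁻¹.permCongr α := by
  rw [permCongr_eq_conj]; simp [krPerm, mul_assoc]

theorem geo_krPerm {α : Perm (Fin m)} : Geo (krPerm α) ↔ Geo α := by
  rw [Geo, Geo, krPerm_krPerm, card_orbs_permCongr, add_comm]

theorem geo_le (α : Perm (Fin m)) (hm : 0 < m) : #(orbs α) + #(orbs (krPerm α)) ≤ m + 1 := by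
  have := card_orbs_add_le α (krPerm α)
  rwa [mul_krPerm, card_orbs_finRotate hm, Fintype.card_fin] at this

/-- The function on `[m]` that separates the points strictly between `e` and `α e` from the
other ones. -/
def psi (α : Perm (Fin m)) (e x : Fin m) : ℚ :=
  (if α e ≤ x then 1 else 0) - if e < x then 1 else 0

/-- The analogue of `psi` on the copy of `[m]`. -/
def chi (α : Perm (Fin m)) (e x : Fin m) : ℚ :=
  (if α e ≤ x then 1 else 0) - if e ≤ x then 1 else 0

/-- With `psi_finRotate`, this says that `psi α e` and `chi α e` alternate around the circle `1, 1‾,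
2, 2‾, …`, jumping only at `e` and at `α e`. It also writes each point mass as a difference of the
two functions. -/
theorem psi_sub_chi (α : Perm (Fin m)) (e x : Fin m) :
    psi α e x - chi α e x = if x = e then 1 else 0 := by
  simp only [psi, chi, Fin.le_def, Fin.lt_def, Fin.ext_iff]
  split_ifs <;> first | omega | norm_num

theorem psi_finRotate (α : Perm (Fin m)) (e x : Fin m) :
    psi α e (finRotate m x) = chi α e x + if finRotate m x = α e then 1 else 0 := by
  have := x.2
  have := e.2
  have := (α e).2
  simp only [psi, chi, Fin.le_def, Fin.lt_def, Fin.ext_iff, val_finRotate]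
  split_ifs <;> first | omega | norm_num

theorem chi_krPerm {α : Perm (Fin m)} {e : Fin m} (h : ∀ x, psi α e (α x) = psi α e x)
    (x : Fin m) : chi α e (krPerm α x) = chi α e x := by
  have h1 := psi_sub_chi α e (krPerm α x)
  have h2 := psi_finRotate α e x
  have h3 := h (krPerm α x)
  simp only [apply_krPerm] at h3
  have h4 : krPerm α x = e ↔ finRotate m x = α e := by
    rw [← apply_krPerm α x, α.apply_eq_iff_eq]
  simp only [h4] at h1
  linarith

theorem mem_fixedFns_finRotate {h : Fin m → ℚ} :
    h ∈ fixedFns (finRotate m) ↔ ∀ x y, h x = h y :=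
  ⟨fun hh => finRotate_const hh, fun hh _ => hh _ _⟩

/-- By `geodesic_iff`, geodesics are the `α` for which every point mass is a sum of an `α`-invariant
and a `krPerm α`-invariant function. The candidates `psi α e` and `-chi α e` are the only possible
such summands up to a constant. -/
theorem geo_iff (hm : 0 < m) {α : Perm (Fin m)} : Geo α ↔ ∀ e x, psi α e (α x) = psi α e x := by
  have key := geodesic_iff α (krPerm α)
  rw [mul_krPerm, card_orbs_finRotate hm, Fintype.card_fin] at key
  rw [Geo, key]
  constructor
  · rintro ⟨h, -⟩ e
    obtain ⟨a, ha, b, hb, hab⟩ := Submodule.mem_sup.1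
      (show (Pi.single e 1 : Fin m → ℚ) ∈ fixedFns α ⊔ fixedFns (krPerm α) by rw [h]; trivial)
    rw [mem_fixedFns] at ha hb
    have hab' : ∀ x, a x + b x = if x = e then 1 else 0 := fun x => by
      rw [← Pi.single_apply, ← hab]; rfl
    -- The `α`-invariant summand `a` has the same jumps around the circle as `psi α e`, so the two
    -- differ by a constant.
    have hd : ∀ x, a (finRotate m x) - psi α e (finRotate m x) = a x - psi α e x := by
      intro x
      have h1 := hab' (krPerm α x)
      have h2 := hab' x
      have h3 := psi_finRotate α e x
      have h4 : krPerm α x = e ↔ finRotate m x = α e := by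
        rw [← apply_krPerm α x, α.apply_eq_iff_eq]
      have h5 := psi_sub_chi α e x
      rw [hb, ← ha, apply_krPerm] at h1
      simp only [h4] at h1
      linarith
    intro x
    have := finRotate_const (h := fun x => a x - psi α e x) hd (α x) x
    simp only [ha] at this
    linarith
  · intro h
    constructor
    · refine eq_top_iff.2 fun f _ => ?_
      have : f = (∑ e, f e • psi α e) + ∑ e, -f e • chi α e := by
        rw [← sum_add_distrib]
        ext x
        rw [Finset.sum_apply, Finset.sum_eq_single x]
        · have := psi_sub_chi α x x
          simp only [Pi.add_apply, Pi.smul_apply, smul_eq_mul, if_true] at this ⊢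
          linear_combination (-f x) * this
        · intro e _ he
          have := psi_sub_chi α e x
          rw [if_neg he.symm] at this
          simp only [Pi.add_apply, Pi.smul_apply, smul_eq_mul]
          linear_combination f e * this
        · simp
      rw [this]
      refine Submodule.add_mem_sup (Submodule.sum_mem _ fun e _ => ?_)
        (Submodule.sum_mem _ fun e _ => ?_)
      · exact Submodule.smul_mem _ _ (h e)
      · exact Submodule.smul_mem _ _ (chi_krPerm (h e))
    · refine le_antisymm ?_ ?_
      · have := fixedFns_inf_le α (krPerm α)
        rwa [mul_krPerm] at this
      · intro f hf
        rw [mem_fixedFns_finRotate] at hf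
        exact ⟨fun _ => hf _ _, fun _ => hf _ _⟩

theorem Geo.pos {α : Perm (Fin m)} (h : Geo α) : 0 < m := by
  rcases Nat.eq_zero_or_pos m with rfl | h'
  · simp [Geo, orbs] at h
  · exact h'

theorem Geo.psi_eq {α : Perm (Fin m)} (h : Geo α) (e : Fin m) {x y : Fin m}
    (hxy : α.SameCycle x y) : psi α e x = psi α e y :=
  eq_of_sameCycle ((geo_iff h.pos).1 h e) hxy

theorem Geo.chi_eq {α : Perm (Fin m)} (h : Geo α) (e : Fin m) {x y : Fin m}
    (hxy : (krPerm α).SameCycle x y) : chi α e x = chi α e y :=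
  eq_of_sameCycle (chi_krPerm ((geo_iff h.pos).1 h e)) hxy

/-- A permutation that maps every point to the cyclically next point of its orbit. -/
def IsNext (α : Perm (Fin m)) : Prop :=
  ∀ x y, α.SameCycle x y → (x < y → x < α x ∧ α x ≤ y) ∧ (α x ≤ x → α x ≤ y ∧ y ≤ x)

/-- This is the invariance of `psi α x` on the orbit of `x` itself: no point of the orbit lies
strictly between `x` and `α x` in the cyclic order. -/
theorem Geo.isNext {α : Perm (Fin m)} (h : Geo α) : IsNext α := by
  intro x y hxy
  have := h.psi_eq x hxy
  simp only [psi, lt_irrefl, if_false, Fin.le_def, Fin.lt_def] at this ⊢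
  constructor <;> intro h <;> split_ifs at this <;> first | omega | norm_num at this

theorem IsNext.ext {α β : Perm (Fin m)} (hα : IsNext α) (hβ : IsNext β)
    (h : orbs α = orbs β) : α = β := by
  have hc : ∀ x y, α.SameCycle x y ↔ β.SameCycle x y := by
    intro x y
    rw [sameCycle_iff_of_mem (orb_mem_orbs α x) (self_mem_orb α x),
      sameCycle_iff_of_mem (h ▸ orb_mem_orbs α x) (self_mem_orb α x)]
  have hα' : ∀ x, α.SameCycle x (α x) := fun x => Perm.sameCycle_apply_right.2 (.refl _ _)
  have hβ' : ∀ x, β.SameCycle x (β x) := fun x => Perm.sameCycle_apply_right.2 (.refl _ _)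
  ext x
  congr 1
  have h1 := hα x (β x) ((hc _ _).2 (hβ' x))
  have h2 := hβ x (α x) ((hc _ _).1 (hα' x))
  rcases le_or_gt (α x) x with h3 | h3
  · have h4 := h1.2 h3
    exact le_antisymm h4.1 (h2.2 h4.2).1
  · have h4 := h2.1 h3
    exact le_antisymm (h1.1 h4.1).2 h4.2

theorem orbs_isPart (α : Perm (Fin m)) : IsPart (orbs α) := by
  refine ⟨fun V hV => nonempty_of_mem_orbs hV, fun V hV W hW hne => ?_,
    fun x => ⟨_, orb_mem_orbs α x, self_mem_orb α x⟩⟩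
  refine Finset.disjoint_left.2 fun z hz hz' => hne ?_
  rw [← orb_eq_of_mem hV hz, ← orb_eq_of_mem hW hz']

theorem Geo.isNC {α : Perm (Fin m)} (h : Geo α) : IsNC (orbs α) := by
  refine ⟨orbs_isPart α, ?_⟩
  intro V hV W hW a ha b hb c hc d hd hab hbc hcd
  by_contra hne
  have hVW : ∀ {e f}, e ∈ V → f ∈ W → e ≠ f := fun he hf h =>
    hne ((orbs_isPart α).eq_of_mem hV hW he (h ▸ hf))
  -- Since `psi α e` takes the same value at `b` and `d`, the arrow from `e` to `α e` cannot cross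
  -- the pair `b, d`. Hence the part of `V` between `b` and `d` is stable under `α`, although it
  -- contains `c` and not `a`.
  have key : ∀ e ∈ V, (b < e ∧ e < d) = (b < α e ∧ α e < d) := by
    intro e he
    have h1 := h.psi_eq e ((sameCycle_iff_of_mem hW hb).2 hd)
    have he' := (apply_mem_iff hV).2 he
    have h2 := hVW he hb
    have h3 := hVW he hd
    have h4 := hVW he' hb
    have h5 := hVW he' hd
    have h6 := hbc.trans hcd
    simp only [psi, Fin.lt_def, Fin.le_def, ne_eq, Fin.ext_iff] at *
    apply propext
    split_ifs at h1 <;> first | omega | norm_num at h1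
  have h2 := eq_of_sameCycle (α := α) (f := fun e => e ∈ V ∧ b < e ∧ e < d) (fun x => by
    rw [eq_iff_iff, apply_mem_iff hV]
    exact and_congr_right fun hx => (iff_of_eq (key x hx)).symm)
    ((sameCycle_iff_of_mem hV ha).2 hc)
  have h3 := (iff_of_eq h2).2 ⟨hc, hbc, hcd⟩
  exact absurd (hab.trans h3.2.1) (lt_irrefl _)

/-- Lying in the same block of the Kreweras complement means that no `chi α e` separates the two
points. The orbits of `krPerm α` have this property by invariance of `chi α e`; conversely these
functions separate the orbits. -/
theorem Geo.krBlock_eq {α : Perm (Fin m)} (h : Geo α) (x : Fin m) :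
    krBlock (orbs α) x = orb (krPerm α) x := by
  have hchi : ∀ {e y}, chi α e x = chi α e y ↔ ((e ≤ x ↔ e ≤ y) ↔ (α e ≤ x ↔ α e ≤ y)) := by
    intro e y
    simp only [chi, Fin.le_def]
    split_ifs <;> first | omega | (norm_num; omega)
  ext y
  rw [mem_krBlock', mem_orb]
  constructor
  · intro hy
    have hy' : ∀ e, chi α e x = chi α e y := fun e => hchi.2
      (hy _ (orb_mem_orbs α e) _ (self_mem_orb α e) _
        (mem_orb.2 (Perm.sameCycle_apply_right.2 (.refl _ _))))
    set f : Fin m → ℚ := fun z => if (krPerm α).SameCycle x z then 1 else 0 with hf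
    have hfK : f ∈ fixedFns (krPerm α) := fun z => by simp [hf, Perm.sameCycle_apply_right]
    -- Expanding the indicator `f` of an orbit in point masses gives one function that is invariant
    -- under both `α` and `krPerm α`, hence constant. Where all `chi α e` agree, `f` must then agree
    -- too.
    have hH : f + ∑ e, f e • chi α e = ∑ e, f e • psi α e := by
      ext z
      rw [Pi.add_apply, Finset.sum_apply, Finset.sum_apply, ← eq_sub_iff_add_eq,
        ← sum_sub_distrib]
      simp only [Pi.smul_apply, ← smul_sub, psi_sub_chi]
      simp
    have h1 : f + ∑ e, f e • chi α e ∈ fixedFns (krPerm α) :=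
      Submodule.add_mem _ hfK (Submodule.sum_mem _ fun e _ =>
        Submodule.smul_mem _ _ (chi_krPerm ((geo_iff h.pos).1 h e)))
    have h2 : f + ∑ e, f e • chi α e ∈ fixedFns α := by
      rw [hH]
      exact Submodule.sum_mem _ fun e _ => Submodule.smul_mem _ _ ((geo_iff h.pos).1 h e)
    have h3 := fixedFns_inf_le α (krPerm α) ⟨h2, h1⟩
    rw [mul_krPerm, mem_fixedFns_finRotate] at h3
    have h4 := h3 x y
    simp only [Pi.add_apply, Finset.sum_apply, Pi.smul_apply, hy', add_left_inj] at h4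
    by_contra hcon
    simp [hf, hcon, Perm.SameCycle.refl] at h4
  · intro hy V hV a ha b hb
    have := eq_of_sameCycle (α := α) (f := fun a => (a ≤ x ↔ a ≤ y))
      (fun e => propext (hchi.1 (h.chi_eq e hy)).symm) ((sameCycle_iff_of_mem hV ha).2 hb)
    exact iff_of_eq this

theorem Geo.Kr_eq {α : Perm (Fin m)} (h : Geo α) : Kr (orbs α) = orbs (krPerm α) := by
  rw [Kr, funext h.krBlock_eq]; rfl

/-- The permutation sends a point to the next larger point of its block, and the maximum of a block
to its minimum. -/
theorem exists_isNext {p : Finset (Finset (Fin m))} (hp : IsPart p) :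
    ∃ α : Perm (Fin m), IsNext α ∧ orbs α = p := by
  choose B hB hxB using hp.cover
  have hBeq : ∀ {x V}, V ∈ p → x ∈ V → B x = V := fun hV hx => hp.eq_of_mem (hB _) hV (hxB _) hx
  let f : Fin m → Fin m := fun x =>
    if h : ({y ∈ B x | x < y}).Nonempty then ({y ∈ B x | x < y}).min' h
    else (B x).min' ⟨x, hxB x⟩
  have f1 : ∀ x y, y ∈ B x → x < y → f x ∈ B x ∧ x < f x ∧ f x ≤ y := by
    intro x y hy hxy
    have h : ({y ∈ B x | x < y}).Nonempty := ⟨y, by simp [hy, hxy]⟩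
    have h1 := min'_mem _ h
    rw [mem_filter] at h1
    simp only [f, dif_pos h]
    exact ⟨h1.1, h1.2, min'_le _ _ (by simp [hy, hxy])⟩
  have f2 : ∀ x, (∀ y ∈ B x, y ≤ x) → f x ∈ B x ∧ ∀ y ∈ B x, f x ≤ y := by
    intro x hx
    have h : ¬ ({y ∈ B x | x < y}).Nonempty := by
      rintro ⟨y, hy⟩
      rw [mem_filter] at hy
      exact absurd (hx y hy.1) (not_le.2 hy.2)
    simp only [f, dif_neg h]
    exact ⟨min'_mem _ _, fun y hy => min'_le _ _ hy⟩
  have f3 : ∀ x, f x ∈ B x := fun x => by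
    by_cases h : ∀ y ∈ B x, y ≤ x
    · exact (f2 x h).1
    · push Not at h
      obtain ⟨y, hy, hxy⟩ := h
      exact (f1 x y hy hxy).1
  have f4 : ∀ x, B (f x) = B x := fun x => hBeq (hB x) (f3 x)
  have finj : Function.Injective f := by
    have aux : ∀ x y, f x = f y → ¬ x < y := by
      intro x y hxy hlt
      have hb : B x = B y := by rw [← f4, hxy, f4]
      have h1 := f1 x y (hb ▸ hxB y) hlt
      by_cases h : ∀ z ∈ B y, z ≤ y
      · have h2 := (f2 y h).2 x (hb ▸ hxB x)
        rw [← hxy] at h2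
        exact absurd h1.2.1 (not_lt.2 h2)
      · push Not at h
        obtain ⟨z, hz, hyz⟩ := h
        have h2 := (f1 y z hz hyz).2.1
        rw [← hxy] at h2
        exact absurd h1.2.2 (not_le.2 h2)
    intro x y hxy
    exact le_antisymm (not_lt.1 (aux y x hxy.symm)) (not_lt.1 (aux x y hxy))
  let α : Perm (Fin m) := Equiv.ofBijective f (Finite.injective_iff_bijective.1 finj)
  have hα : ∀ x, α x = f x := fun _ => rfl
  have hBc : ∀ {x y}, α.SameCycle x y → B x = B y := fun h => eq_of_sameCycle (f := B) f4 h
  -- Climbing from `x` to `y` inside a block: the successor of `x` does not overshoot `y`, so the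
  -- distance decreases.
  have hup : ∀ d : ℕ, ∀ x y : Fin m, (y : ℕ) - x = d → x ≤ y → y ∈ B x → α.SameCycle x y := by
    intro d
    induction d using Nat.strong_induction_on with
    | _ d ih =>
      intro x y hd hxy hy
      rcases hxy.eq_or_lt with rfl | hlt
      · exact .refl _ _
      · obtain ⟨h1, h2, h3⟩ := f1 x y hy hlt
        have h4 : α.SameCycle (f x) y := by
          refine ih (y - f x) ?_ _ _ rfl h3 (by rwa [f4])
          simp only [Fin.lt_def, Fin.le_def] at *
          omega
        exact Perm.sameCycle_apply_left.1 h4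
  have hcyc : ∀ x, orb α x = B x := by
    intro x
    ext y
    rw [mem_orb]
    constructor
    · intro h
      rw [hBc h]
      exact hxB y
    · intro hy
      rcases le_total x y with h | h
      · exact hup _ x y rfl h hy
      · exact (hup _ y x rfl h (by rw [hBeq (hB x) hy]; exact hxB x)).symm
  refine ⟨α, ?_, ?_⟩
  · intro x y hxy
    have hy : y ∈ B x := hBc hxy ▸ hxB y
    refine ⟨fun h => (f1 x y hy h).2, fun h => ?_⟩
    have hmax : ∀ z ∈ B x, z ≤ x := by
      intro z hz
      by_contra hlt
      exact absurd (f1 x z hz (not_le.1 hlt)).2.1 (not_lt.2 h)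
    exact ⟨(f2 x hmax).2 y hy, hmax y hy⟩
  · ext E
    rw [mem_orbs]
    constructor
    · rintro ⟨x, rfl⟩
      rw [hcyc]
      exact hB x
    · intro hE
      obtain ⟨x, hx⟩ := hp.nonempty E hE
      exact ⟨x, by rw [hcyc, hBeq hE hx]⟩

/-- Invariance of `psi α e` along the orbit of `e` holds because `α e` is the next point; along any
other orbit it holds because that orbit cannot cross the pair `e, α e`. -/
theorem IsNext.geo (hm : 0 < m) {α : Perm (Fin m)} (h : IsNext α) (hnc : IsNC (orbs α)) :
    Geo α := by
  rw [geo_iff hm]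
  have hself : ∀ x, α.SameCycle x (α x) := fun x => Perm.sameCycle_apply_right.2 (.refl _ _)
  intro e x
  by_cases hex : α.SameCycle e x
  · have h1 := h e x hex
    have h2 := h e (α x) (hex.trans (hself x))
    simp only [psi, Fin.le_def, Fin.lt_def] at *
    split_ifs <;> first | omega | norm_num
  · have hne : ∀ {a b}, α.SameCycle e a → α.SameCycle x b → a ≠ b := by
      rintro a _ ha hb rfl
      exact hex (ha.trans hb.symm)
    have hVW : orb α e ≠ orb α x := fun h => hex (orb_eq_orb.1 h)
    have hbetween : ∀ {a b y z}, α.SameCycle e a → α.SameCycle e b → α.SameCycle x y →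
        α.SameCycle x z → a < y → y < b → a < z ∧ z < b := by
      intro a b y z ha hb hy hz h1 h2
      rw [← mem_orb] at ha hb hy hz
      have hE := orb_mem_orbs α e
      have hX := orb_mem_orbs α x
      constructor
      · by_contra h3
        have h4 := lt_of_le_of_ne (not_lt.1 h3) (hne (mem_orb.1 ha) (mem_orb.1 hz)).symm
        exact hVW (hnc.noncrossing _ hX _ hE _ hz _ ha _ hy _ hb h4 h1 h2).symm
      · by_contra h3
        have h4 := lt_of_le_of_ne (not_lt.1 h3) (hne (mem_orb.1 hb) (mem_orb.1 hz))
        exact hVW (hnc.noncrossing _ hE _ hX _ ha _ hy _ hb _ hz h1 h2 h4)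
    have e0 := Perm.SameCycle.refl α e
    have x0 := Perm.SameCycle.refl α x
    have e1 := hself e
    have x1 := hself x
    have n1 := hne e0 x0
    have n2 := hne e0 x1
    have n3 := hne e1 x0
    have n4 := hne e1 x1
    have c1 := hbetween e0 e1 x0 x1
    have c2 := hbetween e0 e1 x1 x0
    have c3 := hbetween e1 e0 x0 x1
    have c4 := hbetween e1 e0 x1 x0
    clear hbetween hne hself hVW hex e0 x0 e1 x1 hnc h
    simp only [psi, Fin.le_def, Fin.lt_def, ne_eq, Fin.ext_iff] at *
    split_ifs <;> first | omega | norm_num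

theorem exists_geo (hm : 0 < m) {p : Finset (Finset (Fin m))} (hp : IsNC p) :
    ∃ α : Perm (Fin m), Geo α ∧ orbs α = p := by
  obtain ⟨α, h, rfl⟩ := exists_isNext hp.toIsPart
  exact ⟨α, h.geo hm hp, rfl⟩

theorem Geo.ext {α β : Perm (Fin m)} (hα : Geo α) (hβ : Geo β) (h : orbs α = orbs β) : α = β :=
  hα.isNext.ext hβ.isNext h

theorem Geo.card_orbs_eq {α : Perm (Fin m)} (h : Geo α) : #(orbs α) + #(Kr (orbs α)) = m + 1 := by
  rw [h.Kr_eq]; exact h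

end Geodesic

/-! ### The boxed convolution of type A -/

section Conv

variable {X Y : Type*} [Fintype X] [DecidableEq X] [Fintype Y] [DecidableEq Y]
variable {C : Type*} [CommRing C]

/-- The multiplicative function on permutations with the given values on cycles. -/
def cycleProd (f : ℕ → C) (α : Perm X) : C := ∏ E ∈ orbs α, f #E

/-- The convolution of the multiplicative functions attached to `f` and `g`, over the minimal
factorizations of `δ`. -/
def conv (f g : ℕ → C) (δ : Perm X) : C :=
  ∑ α : Perm X, if #(orbs α) + #(orbs (α⁻¹ * δ)) = Fintype.card X + #(orbs δ) then
    cycleProd f α * cycleProd g (α⁻¹ * δ) else 0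

theorem cycleProd_permCongr (f : ℕ → C) (e : X ≃ Y) (α : Perm X) :
    cycleProd f (e.permCongr α) = cycleProd f α := prod_orbs_permCongr f e α

theorem conv_permCongr (f g : ℕ → C) (e : X ≃ Y) (δ : Perm X) :
    conv f g (e.permCongr δ) = conv f g δ := by
  refine (Fintype.sum_equiv e.permCongr _ _ fun α => ?_).symm
  have : (e.permCongr α)⁻¹ * e.permCongr δ = e.permCongr (α⁻¹ * δ) := by
    rw [inv_mul_eq_iff_eq_mul]; ext x; simp
  rw [this]
  simp only [card_orbs_permCongr, cycleProd_permCongr, Fintype.card_congr e]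

section Sigma

variable {ι : Type*} [Fintype ι] [DecidableEq ι] {Z : ι → Type*} [∀ i, Fintype (Z i)]
  [∀ i, DecidableEq (Z i)]

theorem orb_sigma (a : ∀ i, Perm (Z i)) (i : ι) (x : Z i) :
    orb (Perm.sigmaCongrRightHom Z a) ⟨i, x⟩ = (orb (a i) x).map (Function.Embedding.sigmaMk i) := by
  have hs : ∀ i x, Perm.sigmaCongrRightHom Z a ⟨i, x⟩ = ⟨i, a i x⟩ := fun _ _ => rfl
  ext ⟨j, y⟩
  simp only [mem_orb, mem_map, Function.Embedding.sigmaMk_apply]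
  constructor
  · intro h
    obtain ⟨n, hn⟩ := h.exists_nat_pow_eq
    have hpow : ∀ n : ℕ, ((Perm.sigmaCongrRightHom Z a) ^ n) ⟨i, x⟩ = ⟨i, (a i ^ n) x⟩ := by
      intro n
      induction n with
      | zero => rfl
      | succ n ih => rw [pow_succ', pow_succ', Perm.mul_apply, ih, hs, Perm.mul_apply]
    rw [hpow] at hn
    exact ⟨_, ⟨n, by simp⟩, hn⟩
  · rintro ⟨z, hz, h⟩
    rw [← h]
    exact sameCycle_map (f := Sigma.mk i) (fun x => by
      rw [← hs, Perm.sameCycle_apply_right]) hz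

theorem orbs_sigma (a : ∀ i, Perm (Z i)) :
    orbs (Perm.sigmaCongrRightHom Z a) = (univ.sigma fun i => orbs (a i)).image
      fun s => s.2.map (Function.Embedding.sigmaMk s.1) := by
  ext E
  simp only [mem_orbs, mem_image, mem_sigma, mem_univ, true_and]
  constructor
  · rintro ⟨⟨i, x⟩, rfl⟩
    exact ⟨⟨i, orb (a i) x⟩, ⟨x, rfl⟩, (orb_sigma a i x).symm⟩
  · rintro ⟨⟨i, E⟩, ⟨x, hx⟩, rfl⟩
    exact ⟨⟨i, x⟩, by rw [orb_sigma, ← hx]⟩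

theorem injOn_sigma {ι : Type*} [Fintype ι] {Z : ι → Type*} [∀ i, Fintype (Z i)]
    [∀ i, DecidableEq (Z i)] (a : ∀ i, Perm (Z i)) :
    Set.InjOn (fun s : Σ i, Finset (Z i) => s.2.map (Function.Embedding.sigmaMk s.1))
      (univ.sigma fun i => orbs (a i) : Finset (Σ i, Finset (Z i))) := by
  rintro ⟨i, E⟩ hE ⟨j, F⟩ hF h
  simp only [coe_sigma, Set.mem_sigma_iff, mem_coe] at hE hF h
  obtain ⟨x, hx⟩ := nonempty_of_mem_orbs hE.2
  have h1 : (⟨i, x⟩ : Σ i, Z i) ∈ F.map (Function.Embedding.sigmaMk j) := by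
    rw [← h]; exact mem_map_of_mem _ hx
  obtain ⟨y, -, hy⟩ := mem_map.1 h1
  obtain rfl : j = i := congrArg Sigma.fst hy
  rw [Finset.map_injective _ h]

theorem cycleProd_sigma (f : ℕ → C) (a : ∀ i, Perm (Z i)) :
    cycleProd f (Perm.sigmaCongrRightHom Z a) = ∏ i, cycleProd f (a i) := by
  rw [cycleProd, orbs_sigma, prod_image (injOn_sigma a), prod_sigma]
  simp [cycleProd]

theorem card_orbs_sigma (a : ∀ i, Perm (Z i)) :
    #(orbs (Perm.sigmaCongrRightHom Z a)) = ∑ i, #(orbs (a i)) := by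
  rw [orbs_sigma, card_image_of_injOn (injOn_sigma a), card_sigma]

/-- A minimal factorization of a disjoint union of permutations is a family of minimal
factorizations of the pieces. -/
theorem conv_sigma (f g : ℕ → C) (d : ∀ i, Perm (Z i)) :
    conv f g (Perm.sigmaCongrRightHom Z d) = ∏ i, conv f g (d i) := by
  simp only [conv]
  simp only [← sum_filter]
  rw [prod_univ_sum]
  have hinv : ∀ a : ∀ i, Perm (Z i), (Perm.sigmaCongrRightHom Z a)⁻¹ * Perm.sigmaCongrRightHom Z d
      = Perm.sigmaCongrRightHom Z (a⁻¹ * d) := fun a => by rw [map_mul, map_inv]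
  have hle : ∀ (a : ∀ i, Perm (Z i)) i,
      #(orbs (a i)) + #(orbs ((a i)⁻¹ * d i)) ≤ Fintype.card (Z i) + #(orbs (d i)) := by
    intro a i
    have := card_orbs_add_le (a i) ((a i)⁻¹ * d i)
    rwa [mul_inv_cancel_left] at this
  have hgeo : ∀ a : ∀ i, Perm (Z i), (#(orbs (Perm.sigmaCongrRightHom Z a)) +
      #(orbs ((Perm.sigmaCongrRightHom Z a)⁻¹ * Perm.sigmaCongrRightHom Z d)) =
      Fintype.card (Σ i, Z i) + #(orbs (Perm.sigmaCongrRightHom Z d))) ↔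
      ∀ i, #(orbs (a i)) + #(orbs ((a i)⁻¹ * d i)) = Fintype.card (Z i) + #(orbs (d i)) := by
    intro a
    rw [hinv, card_orbs_sigma, card_orbs_sigma, card_orbs_sigma, Fintype.card_sigma,
      ← sum_add_distrib, ← sum_add_distrib]
    -- The inequality holds on each piece, so equality of the totals is equality on every piece.
    exact (sum_eq_sum_iff_of_le fun i _ => hle a i).trans (by simp)
  symm
  refine sum_bij (fun a _ => Perm.sigmaCongrRightHom Z a) ?_ ?_ ?_ ?_
  · intro a ha
    simp only [Fintype.mem_piFinset, mem_filter, mem_univ, true_and] at ha ⊢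
    exact (hgeo a).2 ha
  · intro a _ b _ h
    exact Perm.sigmaCongrRightHom_injective h
  · intro α hα
    simp only [mem_filter, mem_univ, true_and] at hα
    have h1 := (geodesic_iff α (α⁻¹ * Perm.sigmaCongrRightHom Z d)).1
      (by rwa [mul_inv_cancel_left])
    -- By minimality every function invariant under the product is invariant under `α`. Applied to
    -- the indicator of a piece, this shows that `α` maps the piece to itself.
    have h2 : fixedFns (Perm.sigmaCongrRightHom Z d) ≤ fixedFns α := by
      rw [mul_inv_cancel_left] at h1
      rw [← h1.2]
      exact inf_le_left
    have h3 : ∀ i x, ∃ y, α ⟨i, x⟩ = ⟨i, y⟩ := by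
      intro i x
      have h4 : (fun z : Σ i, Z i => if z.1 = i then (1 : ℚ) else 0) ∈ fixedFns α :=
        h2 fun z => rfl
      have h5 := h4 ⟨i, x⟩
      simp only [if_true] at h5
      have h6 : (α ⟨i, x⟩).1 = i := by
        by_contra hcon
        simp [hcon] at h5
      generalize α ⟨i, x⟩ = w at h6
      obtain ⟨j, y⟩ := w
      subst h6
      exact ⟨y, rfl⟩
    choose a ha using h3
    have hinj : ∀ i, Function.Injective (a i) := by
      intro i x y hxy
      have := α.injective ((ha i x).trans ((congrArg (Sigma.mk i) hxy).trans (ha i y).symm))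
      simpa using this
    have hα' : Perm.sigmaCongrRightHom Z
        (fun i => Equiv.ofBijective (a i) (Finite.injective_iff_bijective.1 (hinj i))) = α := by
      ext1 ⟨i, x⟩
      exact (ha i x).symm
    refine ⟨_, ?_, hα'⟩
    rw [← hα', hgeo] at hα
    simpa using hα
  · intro a _
    rw [hinv, cycleProd_sigma, cycleProd_sigma, ← prod_mul_distrib]
    rfl

end Sigma

/-- Powers of `δ` applied to a base point of each orbit conjugate `δ` to a disjoint union of
standard long cycles. -/
theorem exists_equiv_sigma (δ : Perm X) :
    ∃ e : X ≃ Σ E : {E // E ∈ orbs δ}, Fin #E.1,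
      e.permCongr δ = Perm.sigmaCongrRightHom (fun E : {E // E ∈ orbs δ} => Fin #E.1)
        fun E => finRotate #E.1 := by
  choose z hz using fun E : {E // E ∈ orbs δ} => nonempty_of_mem_orbs E.2
  let F : (Σ E : {E // E ∈ orbs δ}, Fin #E.1) → X := fun s => (δ ^ (s.2 : ℕ)) (z s.1)
  have hcyc : ∀ E ∈ orbs δ, δ.IsCycleOn (E : Set X) := by
    intro E hE
    refine ⟨⟨fun x hx => (apply_mem_iff hE).2 hx, δ.injective.injOn, fun y hy => ⟨δ⁻¹ y, ?_, ?_⟩⟩,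
      fun x hx y hy => (sameCycle_iff_of_mem hE hx).2 hy⟩
    · rw [mem_coe, ← apply_mem_iff hE]
      simpa using hy
    · simp
  have hF : Function.Bijective F := by
    rw [Fintype.bijective_iff_surjective_and_card]
    constructor
    · intro y
      have hE := orb_mem_orbs δ y
      obtain ⟨n, hn, h⟩ := (hcyc _ hE).exists_pow_eq (hz ⟨_, hE⟩) (self_mem_orb δ y)
      exact ⟨⟨⟨_, hE⟩, ⟨n, hn⟩⟩, h⟩
    · rw [Fintype.card_sigma, ← sum_card_orbs δ]
      simp only [Fintype.card_fin]
      exact sum_coe_sort (orbs δ) card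
  refine ⟨(Equiv.ofBijective F hF).symm, ?_⟩
  ext1 ⟨E, t⟩
  rw [Equiv.permCongr_apply, Equiv.symm_symm, Equiv.symm_apply_eq]
  show δ ((δ ^ (t : ℕ)) (z E)) = (δ ^ (finRotate _ t : ℕ)) (z E)
  rw [val_finRotate, ← Perm.mul_apply, ← pow_succ']
  split_ifs with h
  · rw [h, (hcyc _ E.2).pow_card_apply (hz E)]
    rfl
  · rfl

/-- The convolution, a priori defined on all permutations, is again the multiplicative function of
its values on long cycles; this is what allows it to be iterated. -/
theorem cycleProd_conv (f g : ℕ → C) (δ : Perm X) :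
    cycleProd (fun n => conv f g (finRotate n)) δ = conv f g δ := by
  obtain ⟨e, he⟩ := exists_equiv_sigma δ
  rw [← conv_permCongr f g e, he, conv_sigma, cycleProd, ← prod_coe_sort]

theorem ite_sum_zero {ι M : Type*} [AddCommMonoid M] (c : Prop) [Decidable c] (s : Finset ι)
    (F : ι → M) : (if c then ∑ i ∈ s, F i else 0) = ∑ i ∈ s, if c then F i else 0 := by
  split_ifs <;> simp

/-- Both sides are sums over minimal factorizations of `δ` into the three factors `α`, `α⁻¹ * η`,
`η⁻¹ * δ`. -/
theorem conv_assoc (f g h : ℕ → C) (δ : Perm X) :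
    conv (fun n => conv f g (finRotate n)) h δ = conv f (fun n => conv g h (finRotate n)) δ := by
  have h1 : ∀ η : Perm X, (if #(orbs η) + #(orbs (η⁻¹ * δ)) = Fintype.card X + #(orbs δ) then
      conv f g η * cycleProd h (η⁻¹ * δ) else 0) = ∑ α : Perm X,
      if #(orbs α) + #(orbs (α⁻¹ * η)) + #(orbs (η⁻¹ * δ)) = 2 * Fintype.card X + #(orbs δ) then
      cycleProd f α * cycleProd g (α⁻¹ * η) * cycleProd h (η⁻¹ * δ) else 0 := by
    intro η
    rw [conv, sum_mul, ite_sum_zero]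
    refine sum_congr rfl fun α _ => ?_
    -- Given these two inequalities, the single condition on the triple is equivalent to the
    -- conjunction of the two minimality conditions.
    have t1 := card_orbs_add_le α (α⁻¹ * η)
    have t2 := card_orbs_add_le η (η⁻¹ * δ)
    rw [mul_inv_cancel_left] at t1 t2
    split_ifs <;> first | omega | simp
  have h2 : ∀ α : Perm X, (if #(orbs α) + #(orbs (α⁻¹ * δ)) = Fintype.card X + #(orbs δ) then
      cycleProd f α * conv g h (α⁻¹ * δ) else 0) = ∑ η : Perm X,
      if #(orbs α) + #(orbs (α⁻¹ * η)) + #(orbs (η⁻¹ * δ)) = 2 * Fintype.card X + #(orbs δ) then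
      cycleProd f α * cycleProd g (α⁻¹ * η) * cycleProd h (η⁻¹ * δ) else 0 := by
    intro α
    rw [← Equiv.sum_comp (Equiv.mulLeft α), conv, mul_sum, ite_sum_zero]
    refine sum_congr rfl fun β _ => ?_
    have e1 : (α * β)⁻¹ * δ = β⁻¹ * (α⁻¹ * δ) := by group
    have t1 := card_orbs_add_le α (α⁻¹ * δ)
    have t2 := card_orbs_add_le β (β⁻¹ * (α⁻¹ * δ))
    rw [mul_inv_cancel_left] at t1 t2
    simp only [Equiv.coe_mulLeft, inv_mul_cancel_left, e1]
    split_ifs <;> first | omega | simp [mul_assoc]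
  rw [conv, conv]
  simp only [cycleProd_conv]
  rw [sum_congr rfl fun η _ => h1 η, sum_congr rfl fun α _ => h2 α, sum_comm]

/-- The complement `α⁻¹ * δ` swaps the factors, since its own complement is a conjugate of `α` and
so has the same cycle type. -/
theorem conv_comm (f g : ℕ → C) (δ : Perm X) : conv f g δ = conv g f δ := by
  refine Fintype.sum_equiv ((Equiv.inv (Perm X)).trans (Equiv.mulRight δ)) _ _ fun α => ?_
  have h : ((Equiv.inv (Perm X)).trans (Equiv.mulRight δ)) α = α⁻¹ * δ := rfl
  have h' : (α⁻¹ * δ)⁻¹ * δ = δ⁻¹.permCongr α := by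
    rw [permCongr_eq_conj]; group
  rw [h, h', card_orbs_permCongr, cycleProd_permCongr, add_comm, mul_comm]

theorem cycleProd_one (f : ℕ → C) : cycleProd f (1 : Perm X) = f 1 ^ Fintype.card X := by
  rw [cycleProd, orbs_one, prod_image (singleton_injective.injOn)]
  simp

theorem eq_one_of_card_orbs {α : Perm X} (h : #(orbs α) = Fintype.card X) : α = 1 := by
  have hinj : Function.Injective (orb α) := by
    rw [← card_univ, orbs, card_image_iff, coe_univ] at h
    exact Set.injOn_univ.1 h
  ext x
  exact hinj (orb_apply α x)

/-- The multiplicative function attached to the unit series is the indicator of the identity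
permutation. -/
theorem conv_delta (g : ℕ → C) (δ : Perm X) :
    conv (fun n => if n = 1 then 1 else 0) g δ = cycleProd g δ := by
  rw [conv, sum_eq_single 1]
  · simp [card_orbs_one, cycleProd_one]
  · intro α _ hα
    have : ∃ E ∈ orbs α, #E ≠ 1 := by
      by_contra! hcon
      refine hα (eq_one_of_card_orbs ?_)
      rw [← sum_card_orbs α, sum_congr rfl hcon, card_eq_sum_ones]
    obtain ⟨E, hE, h⟩ := this
    have h0 : cycleProd (fun n => if n = 1 then (1 : C) else 0) α = 0 :=
      prod_eq_zero hE (if_neg h)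
    simp [h0]
  · simp

/-- The terms of the convolution on a long cycle that involve the coefficients of `g` of lower
degree only. -/
def convLower (f g : ℕ → C) (m : ℕ) : C :=
  ∑ α ∈ ({α : Perm (Fin m) | Geo α} : Finset _).erase 1, cycleProd f α * cycleProd g (krPerm α)

theorem conv_finRotate {m : ℕ} (hm : 0 < m) (f g : ℕ → C) :
    conv f g (finRotate m) = ∑ α : Perm (Fin m) with Geo α,
      cycleProd f α * cycleProd g (krPerm α) := by
  rw [sum_filter, conv]
  simp only [card_orbs_finRotate hm, Fintype.card_fin]
  rfl

theorem cycleProd_finRotate {m : ℕ} (hm : 0 < m) (f : ℕ → C) :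
    cycleProd f (finRotate m) = f m := by
  simp [cycleProd, orbs_finRotate hm]

theorem conv_eq_add_convLower {m : ℕ} (hm : 0 < m) (f g : ℕ → C) :
    conv f g (finRotate m) = f 1 ^ m * g m + convLower f g m := by
  have h1 : krPerm (1 : Perm (Fin m)) = finRotate m := by simp [krPerm]
  rw [conv_finRotate hm, convLower, ← add_sum_erase _ _ (a := 1)]
  · rw [cycleProd_one, h1, cycleProd_finRotate hm, Fintype.card_fin]
  · exact mem_filter.2 ⟨mem_univ _, by
      rw [Geo, h1, card_orbs_one, card_orbs_finRotate hm, Fintype.card_fin]⟩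

/-- For a geodesic `α ≠ 1` the complement has at least two orbits, so none of them is all of `[m]`.
-/
theorem convLower_congr {m : ℕ} (f : ℕ → C) {g g' : ℕ → C} (h : ∀ n < m, g n = g' n) :
    convLower f g m = convLower f g' m := by
  refine sum_congr rfl fun α hα => ?_
  congr 1
  refine prod_congr rfl fun E hE => h _ ?_
  simp only [mem_erase, mem_filter, mem_univ, true_and] at hα
  have h1 : #(orbs α) ≠ m := fun h1 => hα.1 (eq_one_of_card_orbs (by simpa using h1))
  have h2 : #(orbs α) ≤ m := by simpa using card_orbs_le α
  have h3 := hα.2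
  rw [Geo] at h3
  have h4 := card_le_univ E
  rw [Fintype.card_fin] at h4
  refine lt_of_le_of_ne h4 fun h5 => ?_
  have h6 : E = univ := by
    rw [← card_eq_iff_eq_univ, h5, Fintype.card_fin]
  have h7 : orbs (krPerm α) ⊆ {univ} := by
    intro F hF
    obtain ⟨x, hx⟩ := nonempty_of_mem_orbs hF
    rw [mem_singleton, ← orb_eq_of_mem hF hx, ← h6]
    exact orb_eq_of_mem hE (h6 ▸ mem_univ x)
  have h8 := card_le_card h7
  rw [card_singleton] at h8
  omega

theorem exists_recursive {C : Type*} [Inhabited C] (H : ℕ → (ℕ → C) → C)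
    (hH : ∀ m g g', (∀ n < m, g n = g' n) → H m g = H m g') : ∃ g : ℕ → C, ∀ m, g m = H m g := by
  -- The default fills the arguments `n ≥ m`, on which `H m` does not depend.
  let G : (m : ℕ) → C := fun m => Nat.strongRec (motive := fun _ => C)
    (fun m ih => H m fun n => if h : n < m then ih n h else default) m
  refine ⟨G, fun m => ?_⟩
  have : G m = H m fun n => if h : n < m then G n else default := by
    simp only [G]
    rw [Nat.strongRec]
  rw [this]
  exact hH _ _ _ fun n hn => by simp [hn]

end Conv

/-! ### Associativity, commutativity, unit and inverses in type A. -/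

section BoxA

variable {C : Type*} [CommRing C]

theorem Theta.coeff_mk (γ : ℕ → C) (n : ℕ) :
    (Theta.mk γ).coeff n = if n = 0 then 0 else γ n := by
  simp [Theta.mk, Theta.coeff, PowerSeries.coeff_mk]

theorem Theta.ext' {f g : Theta C} (h : ∀ n, 0 < n → f.coeff n = g.coeff n) : f = g := by
  refine Subtype.ext (PowerSeries.ext fun n => ?_)
  rcases Nat.eq_zero_or_pos n with rfl | hn
  · rw [PowerSeries.coeff_zero_eq_constantCoeff_apply, f.2,
      PowerSeries.coeff_zero_eq_constantCoeff_apply, g.2]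
  · exact h n hn

theorem NC_eq_image {m : ℕ} (hm : 0 < m) :
    NC m = ({α : Perm (Fin m) | Geo α} : Finset _).image orbs := by
  ext p
  simp only [NC, mem_filter, mem_univ, true_and, mem_image]
  exact ⟨exists_geo hm, fun ⟨α, h, hp⟩ => hp ▸ h.isNC⟩

theorem geo_injOn {m : ℕ} :
    Set.InjOn orbs (({α : Perm (Fin m) | Geo α} : Finset _) : Set (Perm (Fin m))) := by
  intro α hα β hβ h
  simp only [coe_filter, mem_univ, true_and, Set.mem_ofPred_eq] at hα hβ
  exact hα.ext hβ h

theorem sum_NC {M : Type*} [AddCommMonoid M] {m : ℕ} (hm : 0 < m)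
    (F : Finset (Finset (Fin m)) → M) :
    ∑ p ∈ NC m, F p = ∑ α : Perm (Fin m) with Geo α, F (orbs α) := by
  rw [NC_eq_image hm, sum_image geo_injOn]

theorem coeff_boxA (f g : Theta C) {m : ℕ} (hm : 0 < m) :
    (boxA f g).coeff m = conv f.coeff g.coeff (finRotate m) := by
  rw [boxA, Theta.coeff_mk, if_neg hm.ne', sum_NC hm, conv_finRotate hm]
  refine sum_congr rfl fun α hα => ?_
  rw [(mem_filter.1 hα).2.Kr_eq]
  rfl

theorem cycleProd_congr {X : Type*} [Fintype X] [DecidableEq X] {f g : ℕ → C}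
    (h : ∀ n, 0 < n → f n = g n) (α : Perm X) : cycleProd f α = cycleProd g α :=
  prod_congr rfl fun _ hE => h _ (card_pos.2 (nonempty_of_mem_orbs hE))

theorem conv_congr {X : Type*} [Fintype X] [DecidableEq X] {f f' g g' : ℕ → C}
    (hf : ∀ n, 0 < n → f n = f' n) (hg : ∀ n, 0 < n → g n = g' n) (δ : Perm X) :
    conv f g δ = conv f' g' δ := by
  simp only [conv, cycleProd_congr hf, cycleProd_congr hg]

theorem boxA_assoc (f g h : Theta C) : boxA (boxA f g) h = boxA f (boxA g h) := by
  refine Theta.ext' fun n hn => ?_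
  rw [coeff_boxA _ _ hn, coeff_boxA _ _ hn,
    conv_congr (fun m hm => coeff_boxA f g hm) (fun _ _ => rfl), conv_assoc,
    conv_congr (fun _ _ => rfl) (fun m hm => coeff_boxA g h hm)]

theorem boxA_comm (f g : Theta C) : boxA f g = boxA g f :=
  Theta.ext' fun n hn => by rw [coeff_boxA _ _ hn, coeff_boxA _ _ hn, conv_comm]

theorem Theta.coeff_delta {n : ℕ} (hn : 0 < n) :
    (Theta.delta : Theta C).coeff n = if n = 1 then 1 else 0 := by
  rw [Theta.delta, Theta.coeff_mk, if_neg hn.ne']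

theorem delta_boxA (f : Theta C) : boxA Theta.delta f = f :=
  Theta.ext' fun n hn => by
    rw [coeff_boxA _ _ hn, conv_congr (fun m hm => Theta.coeff_delta hm) (fun _ _ => rfl),
      conv_delta, cycleProd_finRotate hn]

theorem exists_boxA_eq_delta_iff (f : Theta C) :
    (∃ g, boxA f g = Theta.delta) ↔ IsUnit (f.coeff 1) := by
  constructor
  · rintro ⟨g, hg⟩
    have h1 := congrArg (fun h => Theta.coeff h 1) hg
    -- A one-point set has no permutation but the identity, so degree one reads `α_1 β_1 = 1`.
    have h2 : convLower f.coeff g.coeff 1 = 0 := by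
      rw [convLower, Finset.sum_eq_zero]
      intro α hα
      exact absurd (Subsingleton.elim α 1) (mem_erase.1 hα).1
    simp only [coeff_boxA f g one_pos, Theta.coeff_delta one_pos, if_true,
      conv_eq_add_convLower one_pos, h2, pow_one, add_zero] at h1
    exact IsUnit.of_mul_eq_one _ h1
  · rintro ⟨u, hu⟩
    have : Inhabited C := ⟨0⟩
    -- Degree `m` of the equation is linear in the unknown of degree `m`, with invertible leading
    -- coefficient `u ^ m`, all other terms involving lower degrees only.
    obtain ⟨g, hg⟩ := exists_recursive (fun m g => ((u⁻¹ : Cˣ) : C) ^ m *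
      ((if m = 1 then 1 else 0) - convLower f.coeff g m))
      fun m g g' h => by simp only [convLower_congr f.coeff h]
    refine ⟨Theta.mk g, Theta.ext' fun n hn => ?_⟩
    rw [coeff_boxA _ _ hn, conv_congr (g' := g) (fun _ _ => rfl)
      (fun m hm => by rw [Theta.coeff_mk, if_neg hm.ne']), conv_eq_add_convLower hn,
      Theta.coeff_delta hn, hg n, ← hu, ← mul_assoc, ← mul_pow, Units.mul_inv, one_pow, one_mul,
      sub_add_cancel]

end BoxA

/-! ### Non-crossing partitions of type `k` as lifts of geodesic permutations -/

section Lift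

variable {k n : ℕ}

theorem modNat_mk (i : Fin (k + 1)) (x : Fin n) :
    (finProdFinEquiv (i, x)).modNat = x :=
  congrArg Prod.snd (finProdFinEquiv.symm_apply_apply (i, x))

theorem divNat_mk (i : Fin (k + 1)) (x : Fin n) :
    (finProdFinEquiv (i, x)).divNat = i :=
  congrArg Prod.fst (finProdFinEquiv.symm_apply_apply (i, x))

theorem mk_divNat_modNat (z : Fin ((k + 1) * n)) :
    finProdFinEquiv (z.divNat, z.modNat) = z := finProdFinEquiv.apply_symm_apply z

theorem ext_modNat_divNat {z w : Fin ((k + 1) * n)} (h1 : z.modNat = w.modNat)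
    (h2 : z.divNat = w.divNat) : z = w := by
  rw [← mk_divNat_modNat z, ← mk_divNat_modNat w, h1, h2]

theorem modNat_surjective : Function.Surjective (Fin.modNat : Fin ((k + 1) * n) → Fin n) :=
  fun x => ⟨finProdFinEquiv (0, x), modNat_mk 0 x⟩

theorem card_modNat_eq (x : Fin n) :
    #{z : Fin ((k + 1) * n) | z.modNat = x} = k + 1 := by
  have : ({z : Fin ((k + 1) * n) | z.modNat = x} : Finset _) =
      univ.image fun i : Fin (k + 1) => finProdFinEquiv (i, x) := by
    ext z
    simp only [mem_filter, mem_univ, true_and, mem_image]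
    constructor
    · rintro rfl
      exact ⟨_, mk_divNat_modNat z⟩
    · rintro ⟨i, rfl⟩
      exact modNat_mk i x
  rw [this, card_image_of_injective, card_univ, Fintype.card_fin]
  intro i j h
  simpa using h

/-- The wrap-around at `(k + 1) * n` is compatible with reduction because `n` divides this number.
-/
theorem modNat_finRotate (z : Fin ((k + 1) * n)) :
    (finRotate _ z).modNat = finRotate n z.modNat := by
  have hz := z.2
  have hn : 0 < n := Nat.pos_of_ne_zero fun h => by simp [h] at hz
  have h1 := Nat.div_add_mod (z : ℕ) n
  have h2 := Nat.mod_lt (z : ℕ) hn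
  ext
  rw [val_finRotate, Fin.coe_modNat, val_finRotate, Fin.coe_modNat]
  have h3 : (if (z : ℕ) + 1 = (k + 1) * n then 0 else (z : ℕ) + 1) % n = ((z : ℕ) + 1) % n := by
    split_ifs with h
    · rw [h]; simp
    · rfl
  rw [h3, ← Nat.mod_add_mod]
  split_ifs with h
  · rw [h, Nat.mod_self]
  · exact Nat.mod_eq_of_lt (by omega)

/-- `α` lifts `a` along the reduction mod `n`. -/
def IsLift (α : Perm (Fin ((k + 1) * n))) (a : Perm (Fin n)) : Prop :=
  ∀ z, (α z).modNat = a z.modNat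

instance (α : Perm (Fin ((k + 1) * n))) (a : Perm (Fin n)) : Decidable (IsLift α a) :=
  inferInstanceAs (Decidable (∀ _, _))

variable {α : Perm (Fin ((k + 1) * n))} {a : Perm (Fin n)}

theorem IsLift.krPerm (h : IsLift α a) : IsLift (krPerm α) (krPerm a) := fun z =>
  a.injective (by rw [← h, apply_krPerm, apply_krPerm, modNat_finRotate])

theorem IsLift.redSet_orb (h : IsLift α a) (z : Fin ((k + 1) * n)) :
    redSet (orb α z) = orb a z.modNat := by
  ext y
  simp only [redSet, mem_image, mem_orb]
  constructor
  · rintro ⟨w, hw, rfl⟩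
    exact sameCycle_map (fun x => by rw [h, Perm.sameCycle_apply_right]) hw
  · intro hy
    obtain ⟨t, rfl⟩ := hy.exists_nat_pow_eq
    refine ⟨(α ^ t) z, ⟨t, by simp⟩, ?_⟩
    clear hy
    induction t with
    | zero => rfl
    | succ t ih => rw [pow_succ', pow_succ', Perm.mul_apply, Perm.mul_apply, h, ih]

theorem IsLift.Red_orbs (h : IsLift α a) : Red (orbs α) = orbs a := by
  ext E
  simp only [Red, mem_image, mem_orbs, exists_exists_eq_and, h.redSet_orb]
  constructor
  · rintro ⟨z, hz⟩
    exact ⟨_, hz⟩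
  · rintro ⟨x, hx⟩
    obtain ⟨z, rfl⟩ := modNat_surjective (k := k) x
    exact ⟨z, hx⟩

/-- Every orbit over a reduced block meets the fibre over a chosen point of that block, and this
fibre has `k + 1` elements. -/
theorem card_orbs_le_mul (α : Perm (Fin ((k + 1) * n))) :
    #(orbs α) ≤ (k + 1) * #(Red (orbs α)) := by
  refine card_le_mul_card_image _ _ fun B hB => ?_
  obtain ⟨V, hV, rfl⟩ := mem_image.1 hB
  obtain ⟨z, hz⟩ := nonempty_of_mem_orbs hV
  refine ((card_le_card (t := image (orb α) {w | w.modNat = z.modNat}) ?_).trans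
    card_image_le).trans (card_modNat_eq z.modNat).le
  intro W hW
  rw [mem_filter] at hW
  have : z.modNat ∈ redSet W := by
    rw [hW.2]
    exact mem_image_of_mem _ hz
  obtain ⟨w, hw, hwz⟩ := mem_image.1 this
  exact mem_image.2 ⟨w, by simpa using hwz, orb_eq_of_mem hW.1 hw⟩

theorem exists_blockMap {p : Finset (Finset (Fin n))} (hp : IsPart p) :
    ∃ B : Fin n → {V // V ∈ p}, Function.Surjective B ∧
      ∀ V ∈ p, ∀ x ∈ V, ∀ y ∈ V, B x = B y := by
  choose B hB hxB using hp.cover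
  have h : ∀ V (hV : V ∈ p), ∀ x ∈ V, (⟨B x, hB x⟩ : {V // V ∈ p}) = ⟨V, hV⟩ :=
    fun V hV x hx => Subtype.ext (hp.eq_of_mem (hB x) hV (hxB x) hx)
  refine ⟨fun x => ⟨B x, hB x⟩, ?_, fun V hV x hx y hy => (h V hV x hx).trans (h V hV y hy).symm⟩
  rintro ⟨V, hV⟩
  obtain ⟨x, hx⟩ := hp.nonempty V hV
  exact ⟨x, h V hV x hx⟩

/-- The reductions of the two orbit families are so fine that a point of `[n]` is determined by its
block in each. Those two blocks of the reduction of `krPerm α z` depend only on `z` mod `n`, so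
`krPerm α`, and with it `α`, descends. -/
theorem exists_isLift (hn : 0 < n) {π : Finset (Finset (Fin ((k + 1) * n)))} (hπ : π ∈ NCk k n) :
    ∃ (α : Perm (Fin ((k + 1) * n))) (a : Perm (Fin n)),
      Geo α ∧ Geo a ∧ IsLift α a ∧ orbs α = π := by
  simp only [NCk, mem_filter, mem_univ, true_and] at hπ
  obtain ⟨hπ, hp, hp'⟩ := hπ
  obtain ⟨α, hα, rfl⟩ := exists_geo (show 0 < (k + 1) * n from Nat.mul_pos k.succ_pos hn) hπ
  rw [hα.Kr_eq] at hp'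
  set β := krPerm α with hβ
  obtain ⟨B, hBs, hB⟩ := exists_blockMap hp.toIsPart
  obtain ⟨B', hBs', hB'⟩ := exists_blockMap hp'.toIsPart
  have hBα : ∀ z, B (α z).modNat = B z.modNat := fun z =>
    hB _ (mem_image_of_mem _ (orb_mem_orbs α z)) _
      (mem_image_of_mem _ (by rw [← orb_apply]; exact self_mem_orb _ _)) _
      (mem_image_of_mem _ (self_mem_orb _ _))
  have hBβ : ∀ z, B' (β z).modNat = B' z.modNat := fun z =>
    hB' _ (mem_image_of_mem _ (orb_mem_orbs β z)) _
      (mem_image_of_mem _ (by rw [← orb_apply]; exact self_mem_orb _ _)) _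
      (mem_image_of_mem _ (self_mem_orb _ _))
  -- A function on `[n]` constant on the blocks of both families pulls back to one invariant under
  -- `α` and `β`, hence under the long cycle, so it is constant.
  have hinf : factorFns B ⊓ factorFns B' ≤ fixedFns (finRotate n) := by
    rintro h ⟨h1, h2⟩
    obtain ⟨g1, hg1⟩ := mem_factorFns.1 h1
    obtain ⟨g2, hg2⟩ := mem_factorFns.1 h2
    have h3 : (fun z : Fin ((k + 1) * n) => h z.modNat) ∈ fixedFns (α * β) := by
      refine fixedFns_inf_le α β ⟨fun z => ?_, fun z => ?_⟩
      · simp only [hg1, hBα]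
      · simp only [hg2, hBβ]
    rw [mul_krPerm, mem_fixedFns_finRotate] at h3
    rw [mem_fixedFns_finRotate]
    intro x y
    obtain ⟨z, rfl⟩ := modNat_surjective (k := k) x
    obtain ⟨w, rfl⟩ := modNat_surjective (k := k) y
    exact h3 z w
  -- There are `(k + 1) * n + 1` orbits altogether and at most `k + 1` of them over each reduced
  -- block.
  have hcard : n + 1 ≤ #(Red (orbs α)) + #(Red (orbs β)) := by
    have h1 := card_orbs_le_mul α
    have h2 := card_orbs_le_mul β
    have h3 : #(orbs α) + #(orbs β) = (k + 1) * n + 1 := hα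
    have h4 : (k + 1) * n < (k + 1) * (#(Red (orbs α)) + #(Red (orbs β))) := by
      rw [mul_add]; omega
    exact Nat.lt_of_mul_lt_mul_left h4
  have htop : factorFns B ⊔ factorFns B' = ⊤ := by
    have h1 := Submodule.finrank_sup_add_finrank_inf_eq (factorFns B) (factorFns B')
    have h2 := Submodule.finrank_mono hinf
    have h3 := Submodule.finrank_le (factorFns B ⊔ factorFns B')
    rw [finrank_fixedFns, card_orbs_finRotate hn] at h2
    rw [finrank_factorFns hBs, finrank_factorFns hBs', Fintype.card_coe, Fintype.card_coe] at h1
    refine Submodule.eq_top_of_finrank_eq (le_antisymm h3 ?_)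
    rw [Module.finrank_pi, Fintype.card_fin]
    omega
  -- The two spaces of functions span everything, including the point mass at `x`, so the pair of
  -- block maps separates points.
  have huniq : ∀ x y, B x = B y → B' x = B' y → x = y := by
    intro x y h1 h2
    obtain ⟨u, hu, v, hv, huv⟩ := Submodule.mem_sup.1
      (show (Pi.single x 1 : Fin n → ℚ) ∈ factorFns B ⊔ factorFns B' by rw [htop]; trivial)
    obtain ⟨u', hu'⟩ := mem_factorFns.1 hu
    obtain ⟨v', hv'⟩ := mem_factorFns.1 hv
    have h3 : (Pi.single x 1 : Fin n → ℚ) x = (Pi.single x 1 : Fin n → ℚ) y := by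
      rw [← huv, Pi.add_apply, Pi.add_apply, hu', hv', hu', hv', h1, h2]
    by_contra hne
    rw [Pi.single_eq_same, Pi.single_eq_of_ne (Ne.symm hne)] at h3
    exact one_ne_zero h3
  have hdesc : ∀ z w : Fin ((k + 1) * n), z.modNat = w.modNat → (β z).modNat = (β w).modNat := by
    intro z w hzw
    refine huniq _ _ ?_ ?_
    -- The first block of `β z` is that of `α (β z)`, the rotation of `z`; the second one is that of
    -- `z` itself.
    · rw [← hBα, ← hBα (β w), apply_krPerm, apply_krPerm, modNat_finRotate, modNat_finRotate, hzw]
    · rw [hBβ, hBβ, hzw]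
  choose s hs using modNat_surjective (k := k) (n := n)
  have hb : ∀ z, (β z).modNat = (β (s z.modNat)).modNat := fun z => hdesc _ _ (hs _).symm
  have hbs : Function.Surjective fun x => (β (s x)).modNat := by
    intro y
    refine ⟨(β⁻¹ (s y)).modNat, ?_⟩
    show (β (s (β⁻¹ (s y)).modNat)).modNat = y
    rw [← hb, ← hs y]
    simp [hs]
  let b : Perm (Fin n) := Equiv.ofBijective _ (Finite.surjective_iff_bijective.1 hbs)
  have hlβ : IsLift β b := hb
  have hkr : krPerm (finRotate n * b⁻¹) = b := by simp [krPerm]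
  have hlα : IsLift α (finRotate n * b⁻¹) := by
    intro z
    obtain ⟨w, rfl⟩ := β.surjective z
    rw [apply_krPerm, modNat_finRotate, hlβ]
    simp
  -- The bound `geo_le` and the count `hcard` together give equality, so the descended permutation
  -- is geodesic.
  refine ⟨α, finRotate n * b⁻¹, hα, le_antisymm (geo_le _ hn) ?_, hlα, rfl⟩
  rw [hkr, ← hlα.Red_orbs, ← hlβ.Red_orbs]
  exact hcard

theorem Geo.mem_NCk (hα : Geo α) (ha : Geo a) (h : IsLift α a) : orbs α ∈ NCk k n := by
  simp only [NCk, mem_filter, mem_univ, true_and]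
  rw [hα.Kr_eq, h.Red_orbs, h.krPerm.Red_orbs]
  exact ⟨hα.isNC, ha.isNC, (geo_krPerm.2 ha).isNC⟩

theorem filter_NCk_eq_image (hn : 0 < n) (ha : Geo a) :
    ({π ∈ NCk k n | Red π = orbs a} : Finset _) =
      ({α : Perm (Fin ((k + 1) * n)) | Geo α ∧ IsLift α a} : Finset _).image orbs := by
  ext π
  simp only [mem_filter, mem_univ, true_and, mem_image]
  constructor
  · rintro ⟨hπ, h⟩
    obtain ⟨α, a', hα, ha', hl, rfl⟩ := exists_isLift hn hπ
    rw [hl.Red_orbs] at h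
    obtain rfl := ha'.ext ha h
    exact ⟨α, ⟨hα, hl⟩, rfl⟩
  · rintro ⟨α, ⟨hα, hl⟩, rfl⟩
    exact ⟨hα.mem_NCk ha hl, hl.Red_orbs⟩

/-- The number of orbits of `α` that reduce to `E`. -/
def numOver (α : Perm (Fin ((k + 1) * n))) (E : Finset (Fin n)) : ℕ :=
  #{V ∈ orbs α | redSet V = E}

theorem IsLift.card_orbs_eq_sum (h : IsLift α a) : #(orbs α) = ∑ E ∈ orbs a, numOver α E := by
  refine card_eq_sum_card_fiberwise fun V hV => ?_
  rw [mem_coe, ← h.Red_orbs]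
  exact mem_image_of_mem _ hV

/-- The multiplicity of a block over `E` is the number of its points in any single fibre over `E`.
Over all such blocks these numbers add up to the size `k + 1` of the fibre. -/
theorem IsLift.sum_mult (h : IsLift α a) {E : Finset (Fin n)} (hE : E ∈ orbs a) :
    ∑ V ∈ orbs α with redSet V = E, (#V / #E - 1) = k + 1 - numOver α E := by
  obtain ⟨y, hy⟩ := nonempty_of_mem_orbs hE
  have hfib : ∀ V ∈ orbs α, ∀ x ∈ E, #{z ∈ V | z.modNat = x} = #{z ∈ V | z.modNat = y} := by
    intro V hV x hx
    refine eq_of_sameCycle (α := a) (f := fun x => #{z ∈ V | z.modNat = x}) (fun x => ?_)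
      ((sameCycle_iff_of_mem hE hx).2 hy)
    refine (card_equiv α fun z => ?_).symm
    rw [mem_filter, mem_filter, apply_mem_iff hV, h, a.apply_eq_iff_eq]
  have hdiv : ∀ V ∈ ({V ∈ orbs α | redSet V = E} : Finset _), #V / #E = #{z ∈ V | z.modNat = y} := by
    intro V hV
    rw [mem_filter] at hV
    rw [card_eq_sum_card_fiberwise (f := Fin.modNat) (t := E)
      (fun z hz => by rw [mem_coe, ← hV.2]; exact mem_image_of_mem _ hz),
      sum_congr rfl (hfib V hV.1), sum_const, smul_eq_mul,
      Nat.mul_div_cancel_left _ (card_pos.2 ⟨y, hy⟩)]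
  have hpos : ∀ V ∈ ({V ∈ orbs α | redSet V = E} : Finset _), 1 ≤ #{z ∈ V | z.modNat = y} := by
    intro V hV
    rw [mem_filter] at hV
    rw [← hV.2] at hy
    obtain ⟨z, hz, hzy⟩ := mem_image.1 hy
    exact card_pos.2 ⟨z, by simp [hz, hzy]⟩
  have hsum : ∑ V ∈ orbs α with redSet V = E, #{z ∈ V | z.modNat = y} = k + 1 := by
    refine Eq.trans ?_ (card_modNat_eq (k := k) y)
    rw [card_eq_sum_card_fiberwise (f := orb α) (t := {V ∈ orbs α | redSet V = E})]
    · refine sum_congr rfl fun V hV => ?_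
      rw [mem_filter] at hV
      congr 1
      ext z
      simp only [mem_filter, mem_univ, true_and]
      rw [and_comm]
      exact and_congr_right fun _ => ⟨orb_eq_of_mem hV.1, fun h => h ▸ self_mem_orb α z⟩
    · intro z hz
      simp only [coe_filter, mem_univ, true_and, Set.mem_ofPred_eq] at hz ⊢
      exact ⟨orb_mem_orbs α z, by rw [h.redSet_orb, hz, orb_eq_of_mem hE hy]⟩
  rw [sum_congr rfl fun V hV => by rw [hdiv V hV], sum_tsub_distrib _ hpos, hsum, numOver,
    card_eq_sum_ones]

end Lift

/-! ### Coordinates on the lifts of a geodesic permutation -/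

section Skew

variable {k n : ℕ}

/-- Adding one changes the quotient by `n` only when the remainder carries. -/
theorem divNat_finRotate (z : Fin ((k + 1) * n)) :
    (finRotate _ z).divNat =
      if (z.modNat : ℕ) + 1 = n then finRotate (k + 1) z.divNat else z.divNat := by
  have hz := z.2
  have hn : 0 < n := Nat.pos_of_ne_zero fun h => by simp [h] at hz
  have h1 := Nat.div_add_mod (z : ℕ) n
  have h2 := Nat.mod_lt (z : ℕ) hn
  have hr : (z.modNat : ℕ) = z % n := rfl
  have hd : (z.divNat : ℕ) = z / n := rfl
  have hl : ((finRotate _ z).divNat : ℕ) = (finRotate _ z : ℕ) / n := rfl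
  ext
  rw [hl, val_finRotate, apply_ite Fin.val, val_finRotate, hr, hd]
  by_cases h : (z : ℕ) % n + 1 = n
  · have h3 : (z : ℕ) + 1 = n * (z / n + 1) := by rw [mul_add, mul_one]; omega
    rw [if_pos h]
    have h4 : (z : ℕ) + 1 = (k + 1) * n ↔ (z : ℕ) / n + 1 = k + 1 := by
      rw [h3, mul_comm, Nat.mul_left_inj hn.ne']
    simp only [h4]
    split_ifs
    · simp
    · rw [h3, Nat.mul_div_cancel_left _ hn]
  · have h3 : (z : ℕ) + 1 = n * (z / n) + (z % n + 1) := by omega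
    have h4 : (z : ℕ) + 1 ≠ (k + 1) * n := by
      intro h5
      have h6 : ((z : ℕ) + 1) % n = 0 := by rw [h5]; simp
      rw [h3, Nat.mul_add_mod, Nat.mod_eq_of_lt (by omega)] at h6
      omega
    rw [if_neg h, if_neg h4, h3, Nat.mul_add_div hn,
      Nat.div_eq_of_lt (show (z : ℕ) % n + 1 < n by omega), add_zero]

/-- The lift of `a` with the given action on the fibres of the reduction mod `n`. -/
def skew (a : Perm (Fin n)) (g : Fin n → Perm (Fin (k + 1))) : Perm (Fin ((k + 1) * n)) where
  toFun z := finProdFinEquiv (g z.modNat z.divNat, a z.modNat)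
  invFun z := finProdFinEquiv ((g (a.symm z.modNat)).symm z.divNat, a.symm z.modNat)
  left_inv z := by simp only [modNat_mk, divNat_mk, symm_apply_apply, mk_divNat_modNat]
  right_inv z := by simp only [modNat_mk, divNat_mk, apply_symm_apply, mk_divNat_modNat]

variable (a : Perm (Fin n)) (g : Fin n → Perm (Fin (k + 1)))

theorem modNat_skew (z : Fin ((k + 1) * n)) : (skew a g z).modNat = a z.modNat := modNat_mk _ _

theorem divNat_skew (z : Fin ((k + 1) * n)) :
    (skew a g z).divNat = g z.modNat z.divNat := divNat_mk _ _

theorem isLift_skew : IsLift (skew a g) a := modNat_skew a g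

theorem skew_injective : Function.Injective (skew a : (Fin n → Perm (Fin (k + 1))) → _) := by
  intro g g' h
  ext x i : 2
  have h1 := divNat_skew a g (finProdFinEquiv (i, x))
  have h2 := divNat_skew a g' (finProdFinEquiv (i, x))
  rw [h, h2] at h1
  simpa only [modNat_mk, divNat_mk] using h1.symm

variable {a}

theorem IsLift.exists_skew {α : Perm (Fin ((k + 1) * n))} (h : IsLift α a) :
    ∃ g, skew a g = α := by
  have hinj : ∀ x, Function.Injective fun i => (α (finProdFinEquiv (i, x))).divNat := by
    intro x i j hij
    have := α.injective (ext_modNat_divNat (by rw [h, h, modNat_mk, modNat_mk]) hij)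
    simpa using this
  refine ⟨fun x => Equiv.ofBijective _ (Finite.injective_iff_bijective.1 (hinj x)), ?_⟩
  ext1 z
  refine ext_modNat_divNat (by rw [modNat_skew, h]) ?_
  rw [divNat_skew, Equiv.ofBijective_apply, mk_divNat_modNat]

theorem card_image_le_of_factorsThrough {ι A B : Type*} [Fintype ι] [DecidableEq A]
    [DecidableEq B] {f : ι → A} {g : ι → B} (h : f.FactorsThrough g) :
    #(univ.image f) ≤ #(univ.image g) := by
  rcases isEmpty_or_nonempty ι with hι | ⟨⟨i⟩⟩
  · simp
  · have : univ.image f = (univ.image g).image (Function.extend g f fun _ => f i) := by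
      rw [image_image]
      exact image_congr fun j _ => (h.extend_apply _ j).symm
    rw [this]
    exact card_image_le

/-- If `σ` is the monodromy of the lift `γ` around the orbit `E` of `a`, then the orbits of `γ`
over `E` correspond to the orbits of `σ`. -/
theorem IsLift.numOver_eq {γ : Perm (Fin ((k + 1) * n))} (h : IsLift γ a) {E : Finset (Fin n)}
    (hE : E ∈ orbs a) {m : Fin n} (hm : m ∈ E) (τ : Fin n → Perm (Fin (k + 1)))
    (σ : Perm (Fin (k + 1)))
    (h1 : ∀ z, z.modNat ∈ E → z.modNat ≠ m →
      τ (γ z).modNat (γ z).divNat = τ z.modNat z.divNat)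
    (h2 : ∀ z, z.modNat = m → τ (γ z).modNat (γ z).divNat = σ (τ z.modNat z.divNat)) :
    numOver γ E = #(orbs σ) := by
  have hEγ : ∀ z, (γ z).modNat ∈ E ↔ z.modNat ∈ E := fun z => by rw [h, apply_mem_iff hE]
  -- Follow `γ` from `z` until the fibre over `m` is first reached; the coordinate given by `τ` does
  -- not change on the way.
  have hwalk : ∀ z, z.modNat ∈ E → ∃ w, γ.SameCycle z w ∧ w.modNat = m ∧
      τ w.modNat w.divNat = τ z.modNat z.divNat := by
    intro z hz
    obtain ⟨t, ht⟩ := ((sameCycle_iff_of_mem hE hz).2 hm).exists_nat_pow_eq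
    induction t generalizing z with
    | zero => exact ⟨z, .refl _ _, ht, rfl⟩
    | succ t ih =>
      by_cases hzm : z.modNat = m
      · exact ⟨z, .refl _ _, hzm, rfl⟩
      · obtain ⟨w, hw1, hw2, hw3⟩ := ih (γ z) ((hEγ z).2 hz) (by
          rw [h, ← Perm.mul_apply, ← pow_succ, ht])
        exact ⟨w, Perm.sameCycle_apply_left.1 hw1, hw2, hw3.trans (h1 z hz hzm)⟩
  let pt : Fin (k + 1) → Fin ((k + 1) * n) := fun i => finProdFinEquiv ((τ m).symm i, m)
  have hpt1 : ∀ i, (pt i).modNat = m := fun i => modNat_mk _ _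
  have hpt2 : ∀ i, τ (pt i).modNat (pt i).divNat = i := fun i => by
    simp only [pt, modNat_mk, divNat_mk, apply_symm_apply]
  have hpt : ∀ w, w.modNat = m → pt (τ w.modNat w.divNat) = w := fun w hw => by
    refine ext_modNat_divNat ((hpt1 _).trans hw.symm) ((τ w.modNat).injective ?_)
    have := hpt2 (τ w.modNat w.divNat)
    rwa [hpt1, ← hw] at this
  have hcyc : ∀ i j, γ.SameCycle (pt i) (pt j) ↔ σ.SameCycle i j := by
    intro i j
    constructor
    · intro hij
      have := sameCycle_map (β := σ)
        (f := fun z => if z.modNat ∈ E then τ z.modNat z.divNat else i) (fun z => by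
          simp only [hEγ]
          split_ifs with hz
          · by_cases hzm : z.modNat = m
            · rw [h2 z hzm, Perm.sameCycle_apply_right]
            · rw [h1 z hz hzm]
          · exact .refl _ _) hij
      simpa only [hpt1, if_pos hm, show ∀ i, τ m (pt i).divNat = i from
        fun i => by have := hpt2 i; rwa [hpt1] at this] using this
    · refine fun hij => sameCycle_map (f := pt) (fun i => ?_) hij
      obtain ⟨w, hw1, hw2, hw3⟩ := hwalk (γ (pt i)) ((hEγ _).2 (by rwa [hpt1]))
      rw [h2 _ (hpt1 i), hpt2] at hw3
      rw [← hw3, hpt w hw2]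
      exact Perm.sameCycle_apply_left.1 hw1
  have himg : ({V ∈ orbs γ | redSet V = E} : Finset _) = univ.image fun i => orb γ (pt i) := by
    ext V
    simp only [mem_filter, mem_image, mem_univ, true_and]
    constructor
    · rintro ⟨hV, rfl⟩
      obtain ⟨z, hz, rfl⟩ := mem_image.1 hm
      exact ⟨_, by rw [hpt z rfl, orb_eq_of_mem hV hz]⟩
    · rintro ⟨i, rfl⟩
      exact ⟨orb_mem_orbs _ _, by rw [h.redSet_orb, hpt1, orb_eq_of_mem hE hm]⟩
  rw [numOver, himg, orbs]
  have hiff : ∀ i j, orb γ (pt i) = orb γ (pt j) ↔ orb σ i = orb σ j := fun i j => by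
    rw [orb_eq_orb, orb_eq_orb, hcyc]
  exact le_antisymm (card_image_le_of_factorsThrough fun i j => (hiff i j).2)
    (card_image_le_of_factorsThrough fun i j => (hiff i j).1)

end Skew

/-! ### Sequences of permutations as coordinates on lifts. -/

section Path

variable {k n : ℕ}

/-- The number of elements less than `x` that are mapped to the left or fixed; if `a` is geodesic,
these are the maxima of the orbits of `a`. -/
def numMax (a : Perm (Fin n)) (x : ℕ) : ℕ := #{y : Fin n | (y : ℕ) < x ∧ a y ≤ y}

theorem numMax_zero (a : Perm (Fin n)) : numMax a 0 = 0 := by simp [numMax]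

theorem numMax_succ (a : Perm (Fin n)) (x : Fin n) :
    numMax a (x + 1) = numMax a x + if a x ≤ x then 1 else 0 := by
  have h : ∀ y : Fin n, (y : ℕ) < x + 1 ∧ a y ≤ y ↔ ((y : ℕ) < x ∧ a y ≤ y) ∨ (y = x ∧ a x ≤ x) := by
    intro y
    rw [Nat.lt_succ_iff_lt_or_eq, or_and_right]
    refine or_congr_right ?_
    rw [← Fin.ext_iff]
    exact and_congr_right fun h => h ▸ Iff.rfl
  rw [numMax, numMax, filter_congr fun y _ => h y, filter_or, card_union_of_disjoint]
  · congr 1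
    split_ifs with hx <;> simp [hx, filter_eq']
  · rw [disjoint_filter]
    rintro y - ⟨h1, -⟩ ⟨rfl, -⟩
    exact lt_irrefl _ h1

theorem IsNext.le_of_mem_orb {a : Perm (Fin n)} (h : IsNext a) {x y : Fin n} (hx : a x ≤ x)
    (hy : y ∈ orb a x) : y ≤ x := ((h x y (mem_orb.1 hy)).2 hx).2

theorem exists_apply_le_self {a : Perm (Fin n)} {E : Finset (Fin n)}
    (hE : E ∈ orbs a) : ∃ x ∈ E, a x ≤ x := by
  have hne := nonempty_of_mem_orbs hE
  exact ⟨E.max' hne, max'_mem _ _, le_max' _ _ ((apply_mem_iff hE).2 (max'_mem _ _))⟩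

theorem IsNext.card_filter_orbs {a : Perm (Fin n)} (h : IsNext a) (P : Finset (Fin n) → Prop)
    [DecidablePred P] : #{E ∈ orbs a | P E} = #{x | a x ≤ x ∧ P (orb a x)} := by
  have : ({E ∈ orbs a | P E} : Finset _) =
      ({x | a x ≤ x ∧ P (orb a x)} : Finset (Fin n)).image (orb a) := by
    ext E
    simp only [mem_filter, mem_image, mem_univ, true_and]
    constructor
    · rintro ⟨hE, hP⟩
      obtain ⟨x, hx, hax⟩ := exists_apply_le_self hE
      have := orb_eq_of_mem hE hx
      exact ⟨x, ⟨hax, this ▸ hP⟩, this⟩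
    · rintro ⟨x, ⟨-, hP⟩, rfl⟩
      exact ⟨orb_mem_orbs a x, hP⟩
  rw [this, card_image_of_injOn]
  intro x hx y hy hxy
  simp only [coe_filter, mem_univ, true_and, Set.mem_ofPred_eq] at hx hy
  exact le_antisymm (h.le_of_mem_orb hy.1 (hxy ▸ self_mem_orb a x))
    (h.le_of_mem_orb hx.1 (hxy ▸ self_mem_orb a y))

theorem IsNext.numMax_last {a : Perm (Fin n)} (h : IsNext a) : numMax a n = #(orbs a) := by
  have := h.card_filter_orbs fun _ => True
  simp only [filter_true, and_true] at this
  rw [this, numMax]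
  simp

/-- The sequence `1, q 0, …, q (n - 1), c`, where `c` is the long cycle. -/
def path (q : Fin n → Perm (Fin (k + 1))) (j : ℕ) : Perm (Fin (k + 1)) :=
  if j = 0 then 1 else if h : j - 1 < n then q ⟨j - 1, h⟩ else finRotate (k + 1)

variable (q : Fin n → Perm (Fin (k + 1)))

theorem path_zero : path q 0 = 1 := rfl

theorem path_succ (i : Fin n) : path q (i + 1) = q i := by simp [path]

theorem path_last : path q (n + 1) = finRotate (k + 1) := by simp [path]

/-- The number of blocks of `orbs a ∪ Kr (orbs a)` whose maximum is on the left of `x`. -/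
def tL (a : Perm (Fin n)) (x : ℕ) : ℕ := numMax a x + numMax (krPerm a) x

/-- The number of blocks of `orbs a ∪ Kr (orbs a)` whose maximum is on the left of the copy of
`x`. -/
def tR (a : Perm (Fin n)) (x : ℕ) : ℕ := numMax a (x + 1) + numMax (krPerm a) x

theorem tL_zero (a : Perm (Fin n)) : tL a 0 = 0 := by simp [tL, numMax_zero]

theorem tR_eq (a : Perm (Fin n)) (x : Fin n) : tR a x = tL a x + if a x ≤ x then 1 else 0 := by
  rw [tR, tL, numMax_succ]; ring

theorem tL_succ (a : Perm (Fin n)) (x : Fin n) :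
    tL a (x + 1) = tR a x + if krPerm a x ≤ x then 1 else 0 := by
  rw [tR, tL, numMax_succ (krPerm a)]; ring

variable {a : Perm (Fin n)}

theorem Geo.tL_last (ha : Geo a) : tL a n = n + 1 := by
  rw [tL, ha.isNext.numMax_last, (geo_krPerm.2 ha).isNext.numMax_last]
  exact ha

/-- The action on the fibres of the lift of `a` that is attached to the path `q`. -/
def fibL (a : Perm (Fin n)) (x : Fin n) : Perm (Fin (k + 1)) :=
  (path q (tL a (a x)))⁻¹ * path q (tR a x)

/-- The action on the fibres of the lift of `krPerm a` that is attached to the path `q`. -/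
def fibR (a : Perm (Fin n)) (x : Fin n) : Perm (Fin (k + 1)) :=
  (path q (tR a (krPerm a x)))⁻¹ * path q (tL a (x + 1))

/-- In the composite of the two skew products the factors at `tR` cancel, leaving the values of the
path at `tL` of `x + 1` and of the rotation of `x`. These agree except at the last point, where the
ends `c` and `1` of the path produce the carry of the rotation of `[(k + 1) * n]`. -/
theorem Geo.krPerm_skew (ha : Geo a) :
    krPerm (skew a (fibL q a)) = skew (krPerm a) (fibR q a) := by
  rw [krPerm, inv_mul_eq_iff_eq_mul]
  ext1 z
  rw [Perm.mul_apply]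
  refine ext_modNat_divNat ?_ ?_
  · rw [modNat_skew, modNat_skew, apply_krPerm, modNat_finRotate]
  · rw [divNat_skew, divNat_skew, modNat_skew, divNat_finRotate, fibL, fibR, apply_krPerm,
      Perm.mul_apply, Perm.mul_apply, ← Perm.mul_apply (path q _) (path q _)⁻¹, mul_inv_cancel,
      Perm.one_apply, val_finRotate]
    split_ifs with h
    · rw [h, tL_zero, path_zero, ha.tL_last, path_last]
      simp
    · rw [← Perm.mul_apply, inv_mul_cancel, Perm.one_apply]

/-- In the coordinate `path q (tL a y)` on the fibre over `y`, the lift acts trivially except at the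
maximum `x` of the orbit, where `tR` exceeds `tL` by one. The monodromy around the orbit is
therefore one increment of the path. -/
theorem Geo.numOver_left (ha : Geo a) {x : Fin n} (hx : a x ≤ x) :
    numOver (skew a (fibL q a)) (orb a x) =
      #(orbs (path q (tL a x + 1) * (path q (tL a x))⁻¹)) := by
  have hτ : ∀ z, path q (tL a (skew a (fibL q a) z).modNat) (skew a (fibL q a) z).divNat =
      path q (tR a z.modNat) z.divNat := by
    intro z
    rw [modNat_skew, divNat_skew, fibL, Perm.mul_apply, ← Perm.mul_apply, mul_inv_cancel,
      Perm.one_apply]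
  refine (isLift_skew a _).numOver_eq (orb_mem_orbs a x) (self_mem_orb a x)
    (fun y => path q (tL a y)) _ (fun z hz hzx => ?_) (fun z hz => ?_)
  · rw [hτ, tR_eq, if_neg, add_zero]
    have h1 := ha.isNext.le_of_mem_orb hx hz
    exact not_le.2 ((ha.isNext z.modNat x (mem_orb.1 hz).symm).1 (lt_of_le_of_ne h1 hzx)).1
  · rw [hτ, hz, tR_eq, if_pos hx, Perm.mul_apply, ← Perm.mul_apply _ (path q (tL a x)),
      inv_mul_cancel, Perm.one_apply]

theorem Geo.numOver_right (ha : Geo a) {x : Fin n} (hx : krPerm a x ≤ x) :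
    numOver (skew (krPerm a) (fibR q a)) (orb (krPerm a) x) =
      #(orbs (path q (tR a x + 1) * (path q (tR a x))⁻¹)) := by
  have hb := (geo_krPerm.2 ha).isNext
  have hτ : ∀ z, path q (tR a (skew (krPerm a) (fibR q a) z).modNat)
      (skew (krPerm a) (fibR q a) z).divNat = path q (tL a (z.modNat + 1)) z.divNat := by
    intro z
    rw [modNat_skew, divNat_skew, fibR, Perm.mul_apply, ← Perm.mul_apply, mul_inv_cancel,
      Perm.one_apply]
  refine (isLift_skew (krPerm a) _).numOver_eq (orb_mem_orbs _ x) (self_mem_orb _ x)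
    (fun y => path q (tR a y)) _ (fun z hz hzx => ?_) (fun z hz => ?_)
  · rw [hτ, tL_succ, if_neg, add_zero]
    have h1 := hb.le_of_mem_orb hx hz
    exact not_le.2 ((hb z.modNat x (mem_orb.1 hz).symm).1 (lt_of_le_of_ne h1 hzx)).1
  · rw [hτ, hz, tL_succ, if_pos hx, Perm.mul_apply, ← Perm.mul_apply _ (path q (tR a x)),
      inv_mul_cancel, Perm.one_apply]

end Path

/-! ### The shape of a lift -/

section Blocks

variable {k n : ℕ}

theorem liftBlock_injective (c : Bool) : Function.Injective (liftBlock c : Finset (Fin n) → _) :=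
  fun V W h => by
    ext x
    have : toLex (x, c) ∈ liftBlock c V ↔ toLex (x, c) ∈ liftBlock c W := by rw [h]
    simpa [mem_liftBlock] using this

theorem card_liftBlock (c : Bool) (V : Finset (Fin n)) : #(liftBlock c V) = #V :=
  card_image_of_injective _ fun _ _ h => (Prod.ext_iff.1 (toLex.injective h)).1

theorem liftBlock_ne {V W : Finset (Fin n)} (hV : V.Nonempty) :
    liftBlock false V ≠ liftBlock true W := by
  obtain ⟨x, hx⟩ := hV
  intro h
  have : toLex (x, false) ∈ liftBlock true W := h ▸ mem_liftBlock.2 ⟨hx, rfl⟩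
  exact absurd (mem_liftBlock.1 this).2 (by simp)

theorem disjoint_liftBlock {p q : Finset (Finset (Fin n))} (hp : ∀ V ∈ p, V.Nonempty) :
    Disjoint (p.image (liftBlock false)) (q.image (liftBlock true)) := by
  rw [disjoint_left]
  intro U hU hU'
  obtain ⟨V, hV, rfl⟩ := mem_image.1 hU
  obtain ⟨W, hW, h⟩ := mem_image.1 hU'
  exact liftBlock_ne (hp V hV) h.symm

theorem sum_join {M : Type*} [AddCommMonoid M] {p q : Finset (Finset (Fin n))}
    (hp : ∀ V ∈ p, V.Nonempty) (F : Finset (Doubled n) → M) :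
    ∑ U ∈ join p q, F U = ∑ V ∈ p, F (liftBlock false V) + ∑ W ∈ q, F (liftBlock true W) := by
  rw [join, sum_union (disjoint_liftBlock hp), sum_image (liftBlock_injective _).injOn,
    sum_image (liftBlock_injective _).injOn]

theorem card_join {p q : Finset (Finset (Fin n))} (hp : ∀ V ∈ p, V.Nonempty) :
    #(join p q) = #p + #q := by
  rw [card_eq_sum_ones, sum_join hp, ← card_eq_sum_ones, ← card_eq_sum_ones]

theorem redDoubled_liftBlock (c : Bool) (V : Finset (Fin ((k + 1) * n))) :
    redDoubled (liftBlock c V) = liftBlock c (redSet V) := by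
  simp only [redDoubled, liftBlock, redSet, image_image]
  rfl

theorem image_redDoubled_join (p q : Finset (Finset (Fin ((k + 1) * n)))) :
    (join p q).image redDoubled = join (Red p) (Red q) := by
  simp only [join, image_union, image_image, Red]
  congr 1 <;> exact image_congr fun V _ => redDoubled_liftBlock _ V

theorem max_liftBlock (c : Bool) {V : Finset (Fin n)} {x : Fin n} (hx : x ∈ V)
    (h : ∀ y ∈ V, y ≤ x) : (liftBlock c V).max = (toLex (x, c) : Doubled n) := by
  refine le_antisymm (Finset.max_le fun u hu => ?_)
    (Finset.le_max (mem_liftBlock.2 ⟨hx, rfl⟩))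
  rw [mem_liftBlock] at hu
  rw [WithBot.coe_le_coe, Prod.Lex.le_iff]
  rcases (h _ hu.1).lt_or_eq with h1 | h1
  · exact Or.inl h1
  · exact Or.inr ⟨h1, hu.2.le⟩

theorem rank_injOn {X : Type*} [Fintype X] [LinearOrder X] {P : Finset (Finset X)} (hP : IsNC P) :
    Set.InjOn (rank P) P := fun V hV W hW h => by
  rw [← nthBlock_rank hP hV, h, nthBlock_rank hP hW]

theorem image_rank {X : Type*} [Fintype X] [LinearOrder X] {P : Finset (Finset X)}
    (hP : IsNC P) : P.image (rank P) = range #P := by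
  refine eq_of_subset_of_card_le (fun i hi => ?_) ?_
  · obtain ⟨V, hV, rfl⟩ := mem_image.1 hi
    exact mem_range.2 (rank_lt hP hV)
  · rw [card_range, card_image_of_injOn (rank_injOn hP)]

variable {a : Perm (Fin n)}

theorem Geo.join_isNC (ha : Geo a) : IsNC (join (orbs a) (orbs (krPerm a))) := by
  rw [← ha.Kr_eq]
  exact join_Kr_isNC ha.isNC

theorem Geo.card_join (ha : Geo a) : #(join (orbs a) (orbs (krPerm a))) = n + 1 := by
  rw [BoxedConv.card_join fun _ => nonempty_of_mem_orbs]
  exact ha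

/-- The order of the blocks is the order of their maxima, and the maxima are the points not moved to
the right. -/
theorem Geo.rank_eq (ha : Geo a) {U : Finset (Doubled n)}
    (hU : U ∈ join (orbs a) (orbs (krPerm a))) {u : Doubled n} (hu : U.max = u) :
    rank (join (orbs a) (orbs (krPerm a))) U =
      #{y | a y ≤ y ∧ (toLex (y, false) : Doubled n) < u} +
      #{y | krPerm a y ≤ y ∧ (toLex (y, true) : Doubled n) < u} := by
  have hb := geo_krPerm.2 ha
  rw [rank, filter_congr fun V hV => before_iff ha.join_isNC hV hU, hu, card_filter,
    sum_join fun _ => nonempty_of_mem_orbs, ← card_filter, ← card_filter,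
    ha.isNext.card_filter_orbs, hb.isNext.card_filter_orbs]
  congr 2
  · refine filter_congr fun y _ => and_congr_right fun hy => ?_
    rw [max_liftBlock false (self_mem_orb a y) fun z => ha.isNext.le_of_mem_orb hy,
      WithBot.coe_lt_coe]
  · refine filter_congr fun y _ => and_congr_right fun hy => ?_
    rw [max_liftBlock true (self_mem_orb _ y) fun z => hb.isNext.le_of_mem_orb hy,
      WithBot.coe_lt_coe]

theorem Geo.rank_left (ha : Geo a) {x : Fin n} (hx : a x ≤ x) :
    rank (join (orbs a) (orbs (krPerm a))) (liftBlock false (orb a x)) = tL a x := by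
  rw [ha.rank_eq (mem_join.2 (Or.inl ⟨_, orb_mem_orbs a x, rfl⟩))
    (max_liftBlock false (self_mem_orb a x) fun z => ha.isNext.le_of_mem_orb hx), tL, numMax,
    numMax]
  simp [doubled_lt, and_comm]

theorem Geo.rank_right (ha : Geo a) {x : Fin n} (hx : krPerm a x ≤ x) :
    rank (join (orbs a) (orbs (krPerm a))) (liftBlock true (orb (krPerm a) x)) = tR a x := by
  rw [ha.rank_eq (mem_join.2 (Or.inr ⟨_, orb_mem_orbs _ x, rfl⟩))
    (max_liftBlock true (self_mem_orb _ x) fun z =>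
      (geo_krPerm.2 ha).isNext.le_of_mem_orb hx), tR, numMax, numMax]
  simp [doubled_lt, and_comm, ← le_iff_lt_or_eq]

/-- Each of the `n + 1` positions is taken by a block, identified by its maximum on one of the two
copies of `[n]`. -/
theorem Geo.exists_rank_eq (ha : Geo a) {j : ℕ} (hj : j < n + 1) :
    (∃ x, a x ≤ x ∧ tL a x = j) ∨ ∃ x, krPerm a x ≤ x ∧ tR a x = j := by
  have h : j ∈ (join (orbs a) (orbs (krPerm a))).image (rank (join (orbs a) (orbs (krPerm a)))) := by
    rw [image_rank ha.join_isNC, ha.card_join]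
    exact mem_range.2 hj
  obtain ⟨U, hU, rfl⟩ := mem_image.1 h
  rcases mem_join.1 hU with ⟨E, hE, rfl⟩ | ⟨E, hE, rfl⟩
  · obtain ⟨x, hxE, hx⟩ := exists_apply_le_self hE
    refine Or.inl ⟨x, hx, ?_⟩
    rw [← ha.rank_left hx, orb_eq_of_mem hE hxE]
  · obtain ⟨x, hxE, hx⟩ := exists_apply_le_self hE
    refine Or.inr ⟨x, hx, ?_⟩
    rw [← ha.rank_right hx, orb_eq_of_mem hE hxE]

theorem Geo.sum_rank {M : Type*} [AddCommMonoid M] (ha : Geo a) (F : ℕ → M) :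
    ∑ E ∈ orbs a, F (rank (join (orbs a) (orbs (krPerm a))) (liftBlock false E)) +
      ∑ E ∈ orbs (krPerm a), F (rank (join (orbs a) (orbs (krPerm a))) (liftBlock true E)) =
      ∑ j ∈ range (n + 1), F j := by
  rw [← ha.card_join, ← image_rank ha.join_isNC, sum_image (rank_injOn ha.join_isNC),
    sum_join fun _ => nonempty_of_mem_orbs]

variable {α : Perm (Fin ((k + 1) * n))}

theorem Geo.shape_left (hα : Geo α) (ha : Geo a) (h : IsLift α a) {x : Fin n} (hx : a x ≤ x)
    {j : Fin (n + 1)} (hj : tL a x = j) :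
    shape (orbs α) j = k + 1 - numOver α (orb a x) := by
  have hE := orb_mem_orbs a x
  have hU : liftBlock false (orb a x) ∈ join (orbs a) (orbs (krPerm a)) :=
    mem_join.2 (Or.inl ⟨_, hE, rfl⟩)
  rw [shape, hα.Kr_eq, image_redDoubled_join, h.Red_orbs, h.krPerm.Red_orbs, ← hj,
    ← ha.rank_left hx, nthBlock_rank ha.join_isNC hU, sum_filter,
    sum_join fun _ => nonempty_of_mem_orbs, ← h.sum_mult hE, sum_filter]
  simp only [redDoubled_liftBlock, (liftBlock_injective _).eq_iff,
    (liftBlock_ne (nonempty_of_mem_orbs hE)).symm, if_false, sum_const_zero, add_zero]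
  refine sum_congr rfl fun V _ => ?_
  split_ifs with hV
  · rw [mult, redDoubled_liftBlock, card_liftBlock, card_liftBlock, hV]
  · rfl

theorem Geo.shape_right (hα : Geo α) (ha : Geo a) (h : IsLift α a) {x : Fin n}
    (hx : krPerm a x ≤ x) {j : Fin (n + 1)} (hj : tR a x = j) :
    shape (orbs α) j = k + 1 - numOver (krPerm α) (orb (krPerm a) x) := by
  have hE := orb_mem_orbs (krPerm a) x
  have hU : liftBlock true (orb (krPerm a) x) ∈ join (orbs a) (orbs (krPerm a)) :=
    mem_join.2 (Or.inr ⟨_, hE, rfl⟩)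
  have hne : ∀ V ∈ orbs α, liftBlock false (redSet V) ≠ liftBlock true (orb (krPerm a) x) :=
    fun V hV => liftBlock_ne ((nonempty_of_mem_orbs hV).image _)
  rw [shape, hα.Kr_eq, image_redDoubled_join, h.Red_orbs, h.krPerm.Red_orbs, ← hj,
    ← ha.rank_right hx, nthBlock_rank ha.join_isNC hU, sum_filter,
    sum_join fun _ => nonempty_of_mem_orbs, ← h.krPerm.sum_mult hE, sum_filter]
  simp only [redDoubled_liftBlock, (liftBlock_injective _).eq_iff]
  rw [sum_congr rfl fun V hV => if_neg (hne V hV), sum_const_zero, zero_add]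
  refine sum_congr rfl fun V _ => ?_
  split_ifs with hV
  · rw [mult, redDoubled_liftBlock, card_liftBlock, card_liftBlock, hV]
  · rfl

/-- The number of orbits of the `j`-th increment of the path `q`. -/
def incOrbs (q : Fin n → Perm (Fin (k + 1))) (j : ℕ) : ℕ :=
  #(orbs (path q (j + 1) * (path q j)⁻¹))

variable (q : Fin n → Perm (Fin (k + 1)))

theorem Geo.shape_skew (ha : Geo a) (hα : Geo (skew a (fibL q a))) (j : Fin (n + 1)) :
    shape (orbs (skew a (fibL q a))) j = k + 1 - incOrbs q j := by
  rcases ha.exists_rank_eq j.2 with ⟨x, hx, hj⟩ | ⟨x, hx, hj⟩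
  · rw [hα.shape_left ha (isLift_skew a _) hx hj, ha.numOver_left q hx, hj, incOrbs]
  · rw [hα.shape_right ha (isLift_skew a _) hx hj, ha.krPerm_skew, ha.numOver_right q hx, hj,
      incOrbs]

theorem Geo.card_orbs_skew (ha : Geo a) :
    #(orbs (skew a (fibL q a))) + #(orbs (krPerm (skew a (fibL q a)))) =
      ∑ j ∈ range (n + 1), incOrbs q j := by
  rw [(isLift_skew a _).card_orbs_eq_sum, (isLift_skew a _).krPerm.card_orbs_eq_sum,
    ← ha.sum_rank]
  congr 1
  · refine sum_congr rfl fun E hE => ?_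
    obtain ⟨x, hxE, hx⟩ := exists_apply_le_self hE
    rw [← orb_eq_of_mem hE hxE, ha.numOver_left q hx, ha.rank_left hx, incOrbs]
  · refine sum_congr rfl fun E hE => ?_
    obtain ⟨x, hxE, hx⟩ := exists_apply_le_self hE
    rw [← orb_eq_of_mem hE hxE, ha.krPerm_skew, ha.numOver_right q hx, ha.rank_right hx, incOrbs]

theorem incOrbs_le (j : ℕ) : incOrbs q j ≤ k + 1 := by
  simpa [incOrbs] using card_orbs_le (path q (j + 1) * (path q j)⁻¹)

/-- The lift and its complement have as many orbits as all `n + 1` increments together, and `(n + 1)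
* (k + 1) - k = (k + 1) * n + 1`. -/
theorem Geo.geo_skew_iff (ha : Geo a) :
    Geo (skew a (fibL q a)) ↔ ∑ j ∈ range (n + 1), (k + 1 - incOrbs q j) = k := by
  rw [Geo, ha.card_orbs_skew]
  have h : ∑ j ∈ range (n + 1), (k + 1 - incOrbs q j) + ∑ j ∈ range (n + 1), incOrbs q j =
      (n + 1) * (k + 1) := by
    rw [← sum_add_distrib, sum_congr rfl fun j _ => Nat.sub_add_cancel (incOrbs_le q j)]
    simp
  have h2 : (n + 1) * (k + 1) = (k + 1) * n + 1 + k := by ring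
  omega

/-- The entries of the path are recovered from left to right. An entry changes only where a block
ends, and there the action on the fibres relates the new entry to one already known. -/
theorem Geo.fibL_injective (ha : Geo a) :
    Function.Injective fun q : Fin n → Perm (Fin (k + 1)) => fibL q a := by
  intro q q' hqq
  have hg : ∀ x, (path q (tL a (a x)))⁻¹ * path q (tR a x) =
      (path q' (tL a (a x)))⁻¹ * path q' (tR a x) := fun x => congrFun hqq x
  have key : ∀ x, x ≤ n → (∀ y ≤ x, path q (tL a y) = path q' (tL a y)) ∧
      ∀ y < x, path q (tR a y) = path q' (tR a y) := by
    intro x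
    induction x with
    | zero =>
      intro _
      refine ⟨fun y hy => ?_, fun y hy => absurd hy (Nat.not_lt_zero y)⟩
      rw [Nat.le_zero.1 hy, tL_zero, path_zero, path_zero]
    | succ x ih =>
      intro hx
      obtain ⟨ih1, ih2⟩ := ih (by omega)
      have h1 : path q (tR a x) = path q' (tR a x) := by
        have h := hg ⟨x, hx⟩
        have h' := tR_eq a ⟨x, hx⟩
        by_cases hax : a ⟨x, hx⟩ ≤ ⟨x, hx⟩
        · rw [ih1 _ hax] at h
          exact mul_left_cancel h
        · rw [if_neg hax, add_zero] at h'
          dsimp only at h'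
          rw [h', ih1 x le_rfl]
      have h2 : ∀ y < x + 1, path q (tR a y) = path q' (tR a y) := by
        intro y hy
        rcases Nat.lt_succ_iff_lt_or_eq.1 hy with h | rfl
        · exact ih2 y h
        · exact h1
      refine ⟨fun y hy => ?_, h2⟩
      rcases Nat.le_succ_iff.1 hy with hy | rfl
      · exact ih1 y hy
      have h' := tL_succ a ⟨x, hx⟩
      by_cases hbx : krPerm a ⟨x, hx⟩ ≤ ⟨x, hx⟩
      · by_cases hxn : x + 1 = n
        · rw [Nat.succ_eq_add_one, hxn, ha.tL_last, path_last, path_last]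
        -- The point `krPerm a x ≤ x` is sent by `a` to `x + 1`, so the action on its fibre ties the
        -- entry at `tL a (x + 1)` to a known entry at `tR`.
        · have h := hg (krPerm a ⟨x, hx⟩)
          rw [apply_krPerm, h2 _ (Nat.lt_succ_of_le hbx), val_finRotate, if_neg hxn] at h
          exact inv_injective (mul_right_cancel h)
      · rw [if_neg hbx, add_zero] at h'
        dsimp only at h'
        rw [h', h1]
  have hall : ∀ j < n + 1, path q j = path q' j := by
    intro j hj
    rcases ha.exists_rank_eq hj with ⟨x, -, rfl⟩ | ⟨x, -, rfl⟩
    · exact (key n le_rfl).1 x x.2.le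
    · exact (key n le_rfl).2 x x.2
  funext i
  rw [← path_succ q i, ← path_succ q' i, hall _ (by omega)]

/-- Paths and families of fibre actions form the same finite set, so injectivity gives surjectivity.
-/
theorem Geo.exists_fibL (ha : Geo a) {α : Perm (Fin ((k + 1) * n))} (h : IsLift α a) :
    ∃ q, skew a (fibL q a) = α := by
  obtain ⟨g, rfl⟩ := h.exists_skew
  obtain ⟨q, rfl⟩ := (Finite.injective_iff_surjective.1 (ha.fibL_injective (k := k))) g
  exact ⟨q, rfl⟩

theorem Geo.sum_shape (ha : Geo a) {α : Perm (Fin ((k + 1) * n))} (hα : Geo α)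
    (h : IsLift α a) : ∑ j, shape (orbs α) j = k := by
  obtain ⟨q, rfl⟩ := ha.exists_fibL h
  rw [sum_congr rfl fun j _ => ha.shape_skew q hα j,
    Fin.sum_univ_eq_sum_range fun j => k + 1 - incOrbs q j]
  exact (ha.geo_skew_iff q).1 hα

/-- The right-hand side counts paths with prescribed step lengths and no longer mentions `a`. -/
theorem Geo.numShape_eq (ha : Geo a) (l : Fin (n + 1) → ℕ) (hl : ∑ j, l j = k) :
    numShape k n (orbs a) l =
      #{q : Fin n → Perm (Fin (k + 1)) | ∀ j : Fin (n + 1), k + 1 - incOrbs q j = l j} := by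
  rw [numShape, ← filter_filter, filter_NCk_eq_image ha.pos ha, eq_comm]
  refine card_bij (fun q _ => orbs (skew a (fibL q a))) ?_ ?_ ?_
  · intro q hq
    simp only [mem_filter, mem_univ, true_and] at hq
    have hα : Geo (skew a (fibL q a)) := by
      rw [ha.geo_skew_iff, ← Fin.sum_univ_eq_sum_range fun j => k + 1 - incOrbs q j,
        sum_congr rfl fun j _ => hq j, hl]
    refine mem_filter.2 ⟨mem_image_of_mem _ ?_, funext fun j => ?_⟩
    · simp only [mem_filter, mem_univ, true_and]
      exact ⟨hα, isLift_skew a _⟩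
    · rw [ha.shape_skew q hα, hq]
  · intro q hq q' hq' h
    simp only [mem_filter, mem_univ, true_and] at hq hq'
    have hα : ∀ q : Fin n → Perm (Fin (k + 1)), (∀ j : Fin (n + 1), k + 1 - incOrbs q j = l j) →
        Geo (skew a (fibL q a)) := fun q hq => by
      rw [ha.geo_skew_iff, ← Fin.sum_univ_eq_sum_range fun j => k + 1 - incOrbs q j,
        sum_congr rfl fun j _ => hq j, hl]
    exact ha.fibL_injective (skew_injective a ((hα q hq).ext (hα q' hq') h))
  · intro π hπ
    obtain ⟨hπ, hs⟩ := mem_filter.1 hπ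
    obtain ⟨α, hα, rfl⟩ := mem_image.1 hπ
    simp only [mem_filter, mem_univ, true_and] at hα
    obtain ⟨q, rfl⟩ := ha.exists_fibL hα.2
    refine ⟨q, ?_, rfl⟩
    simp only [mem_filter, mem_univ, true_and]
    intro j
    rw [← ha.shape_skew q hα.1, hs]

end Blocks

/-! ### Paths with prescribed step lengths. -/

section Existence

variable {k n : ℕ}

/-- The functions with equal values at `x` and `y` are invariant, and they form the kernel of one
linear form. -/
theorem card_orbs_swap (x y : Fin (k + 1)) : k ≤ #(orbs (swap x y)) := by
  rw [← finrank_fixedFns]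
  let L : (Fin (k + 1) → ℚ) →ₗ[ℚ] ℚ :=
    (LinearMap.proj x : (Fin (k + 1) → ℚ) →ₗ[ℚ] ℚ) - LinearMap.proj y
  have hle : LinearMap.ker L ≤ fixedFns (swap x y) := by
    intro h hh z
    have hxy : h x = h y := by simpa [L, sub_eq_zero] using hh
    rcases eq_or_ne z x with rfl | hx
    · rw [swap_apply_left, hxy]
    · rcases eq_or_ne z y with rfl | hy
      · rw [swap_apply_right, hxy]
      · rw [swap_apply_of_ne_of_ne hx hy]
  have h1 := Submodule.finrank_mono hle
  have h2 := L.finrank_range_add_finrank_ker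
  have h3 := Submodule.finrank_le (LinearMap.range L)
  rw [Module.finrank_self] at h3
  rw [Module.finrank_pi, Fintype.card_fin] at h2
  omega

/-- The cycle `(0 1 ⋯ s)`. -/
def initCycle (k s : ℕ) : Perm (Fin (k + 1)) := Fin.cycleRange ⟨min s k, by omega⟩

theorem initCycle_eq {s : ℕ} (hs : s < k + 1) : initCycle k s = Fin.cycleRange ⟨s, hs⟩ := by
  rw [initCycle]
  congr 2
  omega

theorem initCycle_zero : initCycle k 0 = 1 := by
  rw [initCycle_eq k.succ_pos]
  exact Fin.cycleRange_zero _

theorem initCycle_self : initCycle k k = finRotate (k + 1) := by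
  rw [initCycle_eq k.lt_succ_self]
  exact Fin.cycleRange_last k

theorem initCycle_succ {s : ℕ} (hs : s < k) :
    initCycle k (s + 1) * (initCycle k s)⁻¹ = swap 0 ⟨s + 1, by omega⟩ := by
  rw [mul_inv_eq_iff_eq_mul, initCycle_eq (by omega), initCycle_eq (by omega)]
  ext1 x
  rw [Perm.mul_apply]
  rcases lt_trichotomy (x : ℕ) s with h | h | h
  · have h1 : x < ⟨s, by omega⟩ := h
    have h2 : x < ⟨s + 1, by omega⟩ := Nat.lt_succ_of_lt h
    have e1 := Fin.coe_cycleRange_of_lt h1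
    have e2 := Fin.coe_cycleRange_of_lt h2
    rw [swap_apply_of_ne_of_ne]
    · ext; rw [e1, e2]
    · intro h3; rw [h3] at e1; simp at e1
    · intro h3; rw [h3] at e1; simp at e1; omega
  · have h1 : x = ⟨s, by omega⟩ := Fin.ext h
    have h2 : x < ⟨s + 1, by omega⟩ := Nat.lt_succ_of_le h.le
    rw [Fin.cycleRange_of_eq h1, swap_apply_left]
    ext
    rw [Fin.coe_cycleRange_of_lt h2, h]
  · rw [Fin.cycleRange_of_gt (show (⟨s, by omega⟩ : Fin (k + 1)) < x from h)]
    rcases (Nat.succ_le_of_lt h).lt_or_eq with h1 | h1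
    · rw [Fin.cycleRange_of_gt (show (⟨s + 1, by omega⟩ : Fin (k + 1)) < x from h1),
        swap_apply_of_ne_of_ne]
      · intro h3; rw [h3] at h; simp at h
      · intro h3; rw [h3] at h1; simp at h1
    · have h2 : x = ⟨s + 1, by omega⟩ := Fin.ext h1.symm
      rw [Fin.cycleRange_of_eq h2, h2, swap_apply_right]

/-- Each step `s → s + 1` is a transposition, so a stretch from `s` to `t` has length at most `t -
s`. The whole path from `1` to the long cycle has length exactly `k`, so every such bound is
attained. -/
theorem card_orbs_initCycle {s t : ℕ} (hst : s ≤ t) (htk : t ≤ k) :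
    k + 1 - #(orbs (initCycle k t * (initCycle k s)⁻¹)) = t - s := by
  have hle : ∀ s t, s ≤ t → t ≤ k →
      k + 1 ≤ #(orbs (initCycle k t * (initCycle k s)⁻¹)) + (t - s) := by
    intro s t hst
    induction t, hst using Nat.le_induction with
    | base => intro _; simp [card_orbs_one]
    | succ t hst ih =>
      intro ht
      have h1 := ih (by omega)
      have h2 := card_orbs_add_le (initCycle k (t + 1) * (initCycle k t)⁻¹)
        (initCycle k t * (initCycle k s)⁻¹)
      have h3 := card_orbs_swap (k := k) 0 ⟨t + 1, by omega⟩
      rw [mul_assoc, inv_mul_cancel_left] at h2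
      rw [← initCycle_succ ht] at h3
      rw [Fintype.card_fin] at h2
      omega
  have h1 := hle s t hst htk
  have h2 := hle 0 s (Nat.zero_le _) (hst.trans htk)
  have h3 := hle t k htk le_rfl
  have h4 := card_orbs_add_le (initCycle k k * (initCycle k t)⁻¹)
    (initCycle k t * (initCycle k s)⁻¹)
  have h5 := card_orbs_add_le (initCycle k k * (initCycle k s)⁻¹)
    (initCycle k s * (initCycle k 0)⁻¹)
  have h6 := card_orbs_finRotate k.succ_pos
  have h7 := card_orbs_le (initCycle k t * (initCycle k s)⁻¹)
  have e1 : initCycle k k * (initCycle k t)⁻¹ * (initCycle k t * (initCycle k s)⁻¹) =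
    initCycle k k * (initCycle k s)⁻¹ := by group
  have e2 : initCycle k k * (initCycle k s)⁻¹ * (initCycle k s * (initCycle k 0)⁻¹) =
    finRotate (k + 1) := by rw [initCycle_zero, initCycle_self]; group
  rw [e1, Fintype.card_fin] at h4
  rw [e2, Fintype.card_fin] at h5
  rw [Fintype.card_fin] at h7
  rw [Nat.succ_eq_add_one] at h6
  omega

theorem exists_incOrbs (l : Fin (n + 1) → ℕ) (hl : ∑ j, l j = k) :
    ∃ q : Fin n → Perm (Fin (k + 1)), ∀ j : Fin (n + 1), k + 1 - incOrbs q j = l j := by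
  let l' : ℕ → ℕ := fun i => if h : i < n + 1 then l ⟨i, h⟩ else 0
  -- The path visits the cycles `initCycle` at the partial sums of `l`, so its increments have
  -- lengths `l j`.
  let L : ℕ → ℕ := fun j => ∑ i ∈ range j, l' i
  have hL : L (n + 1) = k := by
    rw [← hl]
    simp only [L]
    rw [← Fin.sum_univ_eq_sum_range]
    exact sum_congr rfl fun j _ => by simp only [l', dif_pos j.2]
  have hmono : Monotone L := fun i j hij =>
    sum_le_sum_of_subset (range_subset_range.2 hij)
  let q : Fin n → Perm (Fin (k + 1)) := fun i => initCycle k (L (i + 1))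
  have hq : ∀ j ≤ n + 1, path q j = initCycle k (L j) := by
    intro j hj
    rcases Nat.eq_zero_or_pos j with rfl | hj0
    · rw [path_zero]; simp [L, initCycle_zero]
    · obtain ⟨i, rfl⟩ := Nat.exists_eq_succ_of_ne_zero hj0.ne'
      rcases (Nat.le_of_succ_le_succ hj).lt_or_eq with hi | rfl
      · exact path_succ q ⟨i, hi⟩
      · rw [Nat.succ_eq_add_one, path_last, hL, initCycle_self]
  refine ⟨q, fun j => ?_⟩
  have hj := j.2
  rw [incOrbs, hq _ (by omega), hq _ (by omega),
    card_orbs_initCycle (hmono (Nat.le_succ _)) (hL ▸ hmono (by omega))]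
  simp only [L, sum_range_succ, l', dif_pos hj, Nat.add_sub_cancel_left]

end Existence

/-! ### The shape sum and the number `r`. -/

section NumShape

variable {k n : ℕ}

theorem sum_shape_eq (hn : 0 < n) {π : Finset (Finset (Fin ((k + 1) * n)))} (hπ : π ∈ NCk k n) :
    ∑ j, shape π j = k := by
  obtain ⟨α, a, hα, ha, h, rfl⟩ := exists_isLift hn hπ
  exact ha.sum_shape hα h

theorem numShape_eq_r (hn : 0 < n) {l : Fin (n + 1) → ℕ} (hl : ∑ j, l j = k)
    {p : Finset (Finset (Fin n))} (hp : p ∈ NC n) : numShape k n p l = r k n l := by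
  simp only [NC, mem_filter, mem_univ, true_and] at hp
  obtain ⟨a, ha, rfl⟩ := exists_geo hn hp
  have hc : Geo (finRotate n) := by
    rw [Geo, krPerm, inv_mul_cancel, card_orbs_one, card_orbs_finRotate hn, Fintype.card_fin,
      add_comm]
  rw [r, ← orbs_finRotate hn, ha.numShape_eq l hl, hc.numShape_eq l hl]

/-- Needed to cancel the division by `r` in the definition of `boxK`. -/
theorem r_pos (hn : 0 < n) {l : Fin (n + 1) → ℕ} (hl : ∑ j, l j = k) : 0 < r k n l := by
  have hc : Geo (finRotate n) := by
    rw [Geo, krPerm, inv_mul_cancel, card_orbs_one, card_orbs_finRotate hn, Fintype.card_fin,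
      add_comm]
  rw [r, ← orbs_finRotate hn, hc.numShape_eq l hl, card_pos]
  obtain ⟨q, hq⟩ := exists_incOrbs l hl
  exact ⟨q, by simpa using hq⟩

end NumShape

/-! ### The algebra `C_k` -/

namespace Ck

variable {k : ℕ}

/-- `ofSeries` as a monoid homomorphism. -/
noncomputable def ofSeriesHom (k : ℕ) : PowerSeries ℂ →* Ck k where
  toFun := ofSeries k
  map_one' := ofSeries_one
  map_mul' := ofSeries_mul

/-- The components as additive maps. -/
def evalHom (i : Fin (k + 1)) : Ck k →+ ℂ where
  toFun a := a i
  map_zero' := rfl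
  map_add' _ _ := rfl

theorem sum_apply {ι : Type*} (s : Finset ι) (a : ι → Ck k) (i : Fin (k + 1)) :
    (∑ x ∈ s, a x) i = ∑ x ∈ s, a x i := map_sum (evalHom i) a s

theorem comp_ofSeries (f : PowerSeries ℂ) {j : ℕ} (hj : j ≤ k) :
    (ofSeries k f).comp j = (j ! : ℂ) * PowerSeries.coeff j f := by
  rw [comp, dif_pos (Nat.lt_succ_of_le hj), ofSeries]

/-- In terms of power series with coefficients `a^{(i)} / i!`, this is the formula for a coefficient
of a product of several series. -/
theorem prod_apply {n : ℕ} (c : Fin n → Ck k) (i : Fin (k + 1)) :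
    (∏ j, c j) i = ∑ l ∈ piAntidiag (univ : Finset (Fin n)) (i : ℕ),
      multinom i l * ∏ j, (c j).comp (l j) := by
  choose F hF using fun j => ofSeries_surjective (c j)
  have hprod : ∏ j, c j = ofSeries k (∏ j, F j) := by
    rw [← funext hF]
    exact (map_prod (ofSeriesHom k) F univ).symm
  have hcoe : (ofSeries k (∏ j, F j)) i = ((i : ℕ)! : ℂ) * PowerSeries.coeff i (∏ j, F j) := rfl
  rw [hprod, hcoe, PowerSeries.coeff_prod, mul_sum]
  refine sum_bij' (fun l _ => l) (fun l _ => Finsupp.equivFunOnFinite.symm l) ?_ ?_ ?_ ?_ ?_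
  · intro l hl
    rw [mem_finsuppAntidiag] at hl
    simpa [mem_piAntidiag] using hl.1
  · intro l hl
    rw [mem_piAntidiag] at hl
    rw [mem_finsuppAntidiag]
    exact ⟨hl.1, fun _ _ => mem_univ _⟩
  · intro l _
    exact Finsupp.equivFunOnFinite.symm_apply_apply l
  · intro l _
    rfl
  · intro l hl
    rw [mem_finsuppAntidiag] at hl
    have hle : ∀ j, l j ≤ k := fun j => by
      have h1 := single_le_sum (f := l) (fun _ _ => Nat.zero_le _) (mem_univ j)
      have h2 : ∑ j, l j = (i : ℕ) := hl.1
      have h3 := i.2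
      omega
    have h0 : ∏ j, ((l j)! : ℂ) ≠ 0 :=
      prod_ne_zero_iff.2 fun j _ => Nat.cast_ne_zero.2 (Nat.factorial_ne_zero _)
    have h1 : ∏ j, (c j).comp (l j) =
        (∏ j, ((l j)! : ℂ)) * ∏ j, PowerSeries.coeff (l j) (F j) := by
      rw [← prod_mul_distrib]
      exact prod_congr rfl fun j _ => by rw [← hF j, comp_ofSeries _ (hle j)]
    rw [multinom, h1, ← mul_assoc, div_mul_cancel₀ _ h0]

/-- `C_k` is a quotient of the power series ring, in which a series with non-zero constant term is
invertible. -/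
theorem isUnit_iff (a : Ck k) : IsUnit a ↔ a 0 ≠ 0 := by
  have h0 : ∀ f : PowerSeries ℂ, ofSeries k f 0 = PowerSeries.constantCoeff f := fun f => by
    simp [ofSeries]
  obtain ⟨f, rfl⟩ := ofSeries_surjective a
  constructor
  · rintro ⟨u, hu⟩ h
    obtain ⟨g, hg⟩ := ofSeries_surjective (↑u⁻¹ : Ck k)
    have h1 := u.mul_inv
    rw [hu, ← hg, ← ofSeries_mul, ← ofSeries_one] at h1
    have h2 := congrFun h1 0
    rw [h0, h0, map_mul, ← h0 f, h] at h2
    simp at h2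
  · intro h
    rw [h0] at h
    refine IsUnit.of_mul_eq_one (ofSeries k f⁻¹) ?_
    rw [← ofSeries_mul, PowerSeries.mul_inv_cancel _ h, ofSeries_one]

/-- The algebra homomorphism from the polynomials onto `C_k`. -/
noncomputable def ofPoly (k : ℕ) : ℂ[X] →ₐ[ℂ] Ck k :=
  AlgHom.ofLinearMap
    { toFun := fun f => ofSeries k (f : PowerSeries ℂ)
      map_add' := fun f g => by rw [Polynomial.coe_add, ofSeries_add]
      map_smul' := fun c f => by
        rw [Polynomial.coe_smul, ofSeries_smul]; rfl }
    (by simp [ofSeries_one])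
    (fun f g => by simp [ofSeries_mul])

theorem ofPoly_apply (f : ℂ[X]) (i : Fin (k + 1)) :
    ofPoly k f i = ((i : ℕ)! : ℂ) * f.coeff i := by
  show ofSeries k (f : PowerSeries ℂ) i = _
  rw [ofSeries, Polynomial.coeff_coe]

theorem ofPoly_sum (a : Ck k) :
    ofPoly k (∑ i : Fin (k + 1), C (a i / ((i : ℕ)! : ℂ)) * X ^ (i : ℕ)) = a := by
  funext i
  have h : ((i : ℕ)! : ℂ) ≠ 0 := Nat.cast_ne_zero.2 (Nat.factorial_ne_zero _)
  rw [ofPoly_apply, finsetSum_coeff, sum_eq_single i]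
  · rw [coeff_C_mul_X_pow, if_pos rfl]
    field_simp
  · intro j _ hj
    rw [coeff_C_mul_X_pow, if_neg fun h => hj (Fin.ext h.symm)]
  · simp

theorem ker_ofPoly : RingHom.ker (ofPoly k) = Ideal.span {(X : ℂ[X]) ^ (k + 1)} := by
  ext f
  rw [RingHom.mem_ker, Ideal.mem_span_singleton, X_pow_dvd_iff]
  constructor
  · intro h j hj
    have h1 := congrFun h ⟨j, hj⟩
    rw [ofPoly_apply] at h1
    exact (mul_eq_zero.1 h1).resolve_left (Nat.cast_ne_zero.2 (Nat.factorial_ne_zero _))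
  · intro h
    funext i
    rw [ofPoly_apply, h i i.2, mul_zero]
    rfl

theorem exists_algEquiv (k : ℕ) : ∃ e : Ck k ≃ₐ[ℂ] ℂ[X] ⧸ Ideal.span {(X : ℂ[X]) ^ (k + 1)},
    ∀ a : Ck k, e a = Ideal.Quotient.mk _
      (∑ i : Fin (k + 1), C (a i / ((i : ℕ)! : ℂ)) * X ^ (i : ℕ)) := by
  have hs : Function.Surjective (ofPoly k) := fun a => ⟨_, ofPoly_sum a⟩
  refine ⟨((Ideal.quotientEquivAlgOfEq ℂ ker_ofPoly.symm).trans
    (Ideal.quotientKerAlgEquivOfSurjective hs)).symm, fun a => ?_⟩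
  rw [AlgEquiv.symm_apply_eq]
  exact (ofPoly_sum a).symm

end Ck

/-! ### The boxed convolution of type `k` -/

section BoxK

theorem prod_nthBlock {M X : Type*} [CommMonoid M] [Fintype X] [LinearOrder X]
    {P : Finset (Finset X)} (hP : IsNC P) (F : Finset X → M) :
    ∏ i ∈ range #P, F (nthBlock P i) = ∏ E ∈ P, F E := by
  rw [← image_rank hP, prod_image (rank_injOn hP)]
  exact prod_congr rfl fun E hE => by rw [nthBlock_rank hP hE]

theorem prod_Sep {M : Type*} [CommMonoid M] {m : ℕ} (hm : 0 < m) {p : Finset (Finset (Fin m))}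
    (hp : IsNC p) (F G : ℕ → M) :
    ∏ j : Fin (m + 1), (if j.1 < #p then F #(Sep p j) else G #(Sep p j)) =
      (∏ E ∈ p, F #E) * ∏ E ∈ Kr p, G #E := by
  obtain ⟨a, ha, rfl⟩ := exists_geo hm hp
  have hKr : IsNC (Kr (orbs a)) := by
    rw [ha.Kr_eq]; exact (geo_krPerm.2 ha).isNC
  rw [Fin.prod_univ_eq_prod_range
    (fun j => if j < #(orbs a) then F #(Sep (orbs a) j) else G #(Sep (orbs a) j)),
    ← ha.card_orbs_eq, prod_range_add, ← prod_nthBlock hp, ← prod_nthBlock hKr]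
  congr 1
  · refine prod_congr rfl fun j hj => ?_
    have hj := mem_range.1 hj
    rw [if_pos hj, Sep, if_pos hj]
  · refine prod_congr rfl fun j _ => ?_
    have hj : ¬ #(orbs a) + j < #(orbs a) := by omega
    rw [if_neg hj, Sep, if_neg hj, Nat.add_sub_cancel_left]

variable {k : ℕ}

theorem coeff_boxK (f g : Theta (Ck k)) {m : ℕ} (hm : 0 < m) (i : Fin (k + 1)) :
    (boxK f g).coeff m i = ∑ π ∈ NCk i m,
      multinom i (shape π) / (r i m (shape π) : ℂ) * ∏ j : Fin (m + 1),
        (if j.1 < #(Red π) then f.coeff #(Sep (Red π) j) else g.coeff #(Sep (Red π) j)).comp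
          (shape π j) := by
  refine (congrFun ((Theta.coeff_mk (C := Ck k) _ m).trans (if_neg hm.ne')) i :
    (boxK f g).coeff m i = _).trans ?_
  refine sum_congr rfl fun π _ => ?_
  rw [mul_assoc, ← prod_filter_mul_prod_filter_not univ fun j : Fin (m + 1) => j.1 < #(Red π)]
  congr 2
  · exact prod_congr rfl fun j hj => by rw [if_pos (mem_filter.1 hj).2]
  · refine prod_congr (filter_congr fun j _ => not_lt.symm) fun j hj => ?_
    rw [if_neg (mem_filter.1 hj).2]

/-- The coordinates of the shape follow the mixed order of the blocks while the factors follow the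
separated one. This is harmless: after cancelling `r`, every `l` with sum `i` occurs with its
multinomial coefficient alone, which is the expansion of the product of the factors in the order in
which they are listed. -/
theorem boxK_eq_boxA (f g : Theta (Ck k)) : boxK f g = boxA f g := by
  refine Theta.ext' fun m hm => ?_
  funext i
  rw [coeff_boxK f g hm, boxA, Theta.coeff_mk, if_neg hm.ne', Ck.sum_apply]
  rw [← sum_fiberwise_of_maps_to (g := Red) (t := NC m) fun π hπ => by
    simp only [NCk, mem_filter, mem_univ, true_and] at hπ
    simpa [NC] using hπ.2.1]
  refine sum_congr rfl fun p hp => ?_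
  have hp' : IsNC p := by simpa [NC] using hp
  rw [← prod_Sep hm hp' f.coeff g.coeff, Ck.prod_apply]
  rw [← sum_fiberwise_of_maps_to (g := shape) (t := piAntidiag univ (i : ℕ)) fun π hπ => by
    simpa [mem_piAntidiag] using sum_shape_eq hm (mem_filter.1 hπ).1]
  refine sum_congr rfl fun l hl => ?_
  have hl' : ∑ j, l j = (i : ℕ) := (mem_piAntidiag.1 hl).1
  have h0 : (r i m l : ℂ) ≠ 0 := Nat.cast_ne_zero.2 (r_pos hm hl').ne'
  -- For a fixed reduction and shape the summand is constant, and there are `r` summands.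
  rw [sum_congr rfl fun π hπ => by
    obtain ⟨hπ, hs⟩ := mem_filter.1 hπ
    rw [(mem_filter.1 hπ).2, hs], sum_const, filter_filter]
  have hcard := numShape_eq_r hm hl' hp
  rw [numShape] at hcard
  rw [hcard, nsmul_eq_mul, ← mul_assoc, mul_div_cancel₀ _ h0]

end BoxK

end BoxedConv

/-! ### Conclusion. -/

theorem mainTheorem2 (k : ℕ) :
    (∃ e : Ck k ≃ₐ[ℂ] ℂ[X] ⧸ Ideal.span {(X : ℂ[X]) ^ (k + 1)},
      ∀ a : Ck k, e a = Ideal.Quotient.mk _ (∑ i : Fin (k + 1), C (a i / ((i : ℕ)! : ℂ)) * X ^ (i : ℕ))) ∧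
    (∀ i m : ℕ, 0 < m →
      (∀ π ∈ NCk i m, ∑ j, shape π j = i) ∧
      ∀ l : Fin (m + 1) → ℕ, ∑ j, l j = i → ∀ p ∈ NC m, numShape i m p l = r i m l) ∧
    (∀ f g : Theta (Ck k), boxK f g = boxA f g) ∧
    (∀ f g h : Theta (Ck k), boxK (boxK f g) h = boxK f (boxK g h)) ∧
    (∀ f g : Theta (Ck k), boxK f g = boxK g f) ∧
    (∀ f : Theta (Ck k), boxK Theta.delta f = f ∧ boxK f Theta.delta = f) ∧
    ∀ f : Theta (Ck k),
      (∃ g : Theta (Ck k), boxK f g = Theta.delta ∧ boxK g f = Theta.delta) ↔ f.coeff 1 0 ≠ 0 := by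
  simp only [boxK_eq_boxA]
  refine ⟨Ck.exists_algEquiv k, fun i m hm => ⟨fun π hπ => sum_shape_eq hm hπ,
    fun l hl p hp => numShape_eq_r hm hl hp⟩, fun _ _ => trivial, boxA_assoc, boxA_comm,
    fun f => ⟨delta_boxA f, (boxA_comm _ _).trans (delta_boxA f)⟩, fun f => ?_⟩
  rw [← Ck.isUnit_iff, ← exists_boxA_eq_delta_iff]
  exact exists_congr fun g => ⟨fun h => h.1, fun h => ⟨h, (boxA_comm _ _).trans h⟩⟩
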